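/- Consider the prepare-and-measure scenario for a qubit. Alice is given an arbitrary density operator $\rho$ on $\mathbb C^2$, Bob is given an arbitrary POVM $M=\{M_b\}_{b=1}^n$ on $\mathbb C^2$ (with any finite number $n$ of outcomes) and has to output $b$ with probability $\operatorname{tr}(\rho M_b)$. In a classical model they share a random variable $\lambda$, Alice sends a classical message $c$ drawn from $p_A(c\mid\rho,\lambda)$, and Bob outputs $b$ with probability $p_B(b\mid c,M,\lambda)$; the model simulates the qubit if $\int \sum_c p_A(c\mid\rho,\lambda)\,p_B(b\mid c,M,\lambda)\,d\pi(\lambda)=\operatorname{tr}(\rho M_b)$ for all $\rho,M,b$. Messages are words of bits and trits, where a bit has length $1$ and a trit has length $\log_2 3$. The average communication cost is $\sup_\rho\int\sum_c p_A(c\mid\rho,\lambda)\,\ell(c)\,d\pi(\lambda)$, where $\ell(c)$ is the length of $c$, and the worst-case cost is the largest length of a message that can be sent. Consider the following single-shot protocol. 1. $\lambda=(\vec\lambda_1,\vec\lambda_2)$ consists of two independent uniformly distributed vectors on the unit sphere $\mathbb S^2$. Put $\Theta(z)=1$ for $z\ge0$, $\Theta(z)=0$ for $z<0$, and $S_{ij}=\{\vec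 r\in\mathbb S^2: \Theta(\vec r\cdot\vec\lambda_1)=i,\ \Theta(\vec r\cdot\vec\lambda_2)=j\}$. 2. If $\rho=\frac12(\mathbb 1+\vec x\cdot\vec\sigma)$ is pure and $\vec x\in S_{ij}$, Alice sends the codeword of $S_{ij}$ in the following table, where $\measuredangle(\vec\lambda_1,\vec\lambda_2)=\pi\log_2\beta$ with $\beta\in[1,2]$ (subscripts $2$ and $3$ denote bits and trits): $$\begin{array}{l|l|l|l|l|l} \beta & [1,\tfrac98] & (\tfrac98,\tfrac43] & (\tfrac43,\tfrac32) & [\tfrac32,\tfrac{16}9) & [\tfrac{16}9,2]\\ \hline S_{00} & 0_2 & 0_3 & 00_2 & 2_31_2 & 111_2\\ S_{11} & 10_2 & 1_3 & 11_2 & 2_30_2 & 110_2\\ S_{01} & 110_2 & 2_30_2 & 01_2 & 1_3 & 10_2\\ S_{10} & 111_2 & 2_31_2 & 10_2 & 0_3 & 0_2 \end{array}$$ If $\rho$ is mixed, she draws a member of an orthonormal eigenbasis of $\rho$ with its eigenvalue as probability and does the same for it. 3. Bob decodes $(i,j)$ and sets $\vec\mu_1=(-1)^{1+i}\vec\lambda_1$,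 $\vec\mu_2=(-1)^{1+j}\vec\lambda_2$. He splits every $M_b$ spectrally, $M_b=\sum_{s=\pm}p_{b,s}(\mathbb 1+\vec y_{b,s}\cdot\vec\sigma)$ with $p_{b,s}\ge0$, $|\vec y_{b,s}|=1$, and draws $k=(b,s)$ with probability $p_k$. He puts $\vec\mu=\vec\mu_1$ if $|\vec\mu_1\cdot\vec y_k|\ge|\vec\mu_2\cdot\vec y_k|$ and $\vec\mu=\vec\mu_2$ otherwise, draws $k'=(b',s')$ with probability $p_{k'}\max(0,\vec y_{k'}\cdot\vec\mu)\big/\sum_j p_j\max(0,\vec y_j\cdot\vec\mu)$ (or $p_{k'}$ if the denominator vanishes), and outputs $b'$. Then this is a well-defined classical model that simulates the qubit exactly, for all states and all POVMs. For every value of $\lambda$ the code is prefix-free. The average communication cost is exactly $$\bar{\mathcal C}=\frac32-\frac{\sin(\pi\log_2 3)}{\pi}-\frac{\sin(2\pi\log_2 3)}{2\pi},\qquad |\bar{\mathcal C}-1.89|<0.005 ,$$ in bits, and the worst-case communication cost is exactly $3$ bits. Moreover, for every $\lambda$, the messages that can be sent can be labelled injectively by an alphabet of $d_C=2^3$ letters.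 -/

import Mathlib

open MeasureTheory
open scoped ComplexOrder

noncomputable section

namespace PrepareMeasure

/-! ### The quantum prepare-and-measure scenario -/

/-- Density operators of a `d`-dimensional quantum system. -/
def DensityMatrix (d : ℕ) : Type :=
  {ρ : Matrix (Fin d) (Fin d) ℂ // ρ.PosSemidef ∧ ρ.trace = 1}

/-- POVMs with `n` outcomes on a `d`-dimensional quantum system. -/
def POVM (d n : ℕ) : Type :=
  {M : Fin n → Matrix (Fin d) (Fin d) ℂ // (∀ b, (M b).PosSemidef) ∧ ∑ b, M b = 1}

/-- Bob's inputs: all POVMs with any finite number of outcomes. -/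
abbrev Measurement (d : ℕ) : Type := Σ n : ℕ, POVM d n

/-- The outcome set of a measurement. -/
abbrev Outcome {d : ℕ} (y : Measurement d) : Type := Fin y.1

/-- Born's rule `p_Q(b | ρ, M) = tr (ρ M_b)`. -/
def bornProb {d : ℕ} (ρ : DensityMatrix d) (y : Measurement d) (b : Outcome y) : ℂ :=
  (ρ.1 * y.2.1 b).trace

/-! ### Classical models with shared randomness -/

/-- The data of a one-way communication model: shared randomness in `Λ` with law `law`, Alice's
message probabilities `alice x l c = p_A(c | x, l)`, Bob's outcome probabilities
`bob y l c b = p_B(b | c, y, l)`, and the length `length c` of the message `c` in bits. -/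
structure ClassicalModel (X Y : Type) (B : Y → Type) (Λ : Type) [MeasurableSpace Λ]
    (Msg : Type) where
  law : Measure Λ
  alice : X → Λ → Msg → ℝ
  bob : (y : Y) → Λ → Msg → B y → ℝ
  length : Msg → ℝ

namespace ClassicalModel

variable {X Y : Type} {B : Y → Type} {Λ : Type} [MeasurableSpace Λ] {Msg : Type}

/-- The shared randomness is a random variable and both responses are (measurable families of)
probability distributions. -/
def IsValid (P : ClassicalModel X Y B Λ Msg) : Prop :=
  IsProbabilityMeasure P.law ∧
  (∀ x l c, 0 ≤ P.alice x l c) ∧ (∀ x l, HasSum (P.alice x l) 1) ∧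
  (∀ x c, Measurable fun l => P.alice x l c) ∧
  (∀ y l c b, 0 ≤ P.bob y l c b) ∧ (∀ y l c, HasSum (P.bob y l c) 1) ∧
  (∀ y c b, Measurable fun l => P.bob y l c b)

/-- The behavior `p_C(b | x, y) = ∫ ∑_c p_A(c | x, l) p_B(b | c, y, l) dπ(l)`. -/
def behavior (P : ClassicalModel X Y B Λ Msg) (x : X) (y : Y) (b : B y) : ℝ :=
  ∫ l, ∑' c, P.alice x l c * P.bob y l c b ∂P.law

/-- The expected number of bits sent on input `x` when the shared randomness is `l`. -/
def expectedLength (P : ClassicalModel X Y B Λ Msg) (x : X) (l : Λ) : ℝ :=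
  ∑' c, P.alice x l c * P.length c

/-- The average communication cost `sup_x ∫ ℓ(x, l) dπ(l)` exists and equals `C`. -/
def HasAverageCost (P : ClassicalModel X Y B Λ Msg) (C : ℝ) : Prop :=
  (∀ x l, Summable fun c => P.alice x l c * P.length c) ∧
  (∀ x, Integrable (P.expectedLength x) P.law) ∧
  IsLUB (Set.range fun x => ∫ l, P.expectedLength x l ∂P.law) C

/-- The messages which can occur when the shared randomness is `l`. -/
def sentMessages (P : ClassicalModel X Y B Λ Msg) (l : Λ) : Set Msg :=
  {c | ∃ x, 0 < P.alice x l c}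

/-- The largest number of bits that is ever sent is attained and equals `C`. -/
def HasWorstCaseCost (P : ClassicalModel X Y B Λ Msg) (C : ℝ) : Prop :=
  IsGreatest {r | ∃ l, ∃ c ∈ P.sentMessages l, P.length c = r} C

/-- For every value of the shared randomness, the messages which can occur can be relabelled
(with labels known to both parties) by an alphabet with `d` letters. -/
def FitsAlphabet (P : ClassicalModel X Y B Λ Msg) (d : ℕ) : Prop :=
  ∃ label : Λ → Msg → Fin d, ∀ l, Set.InjOn (label l) (P.sentMessages l)

end ClassicalModel

/-- The classical model reproduces all statistics of a `d`-dimensional quantum system. -/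
def Simulates (d : ℕ) {Λ : Type} [MeasurableSpace Λ] {Msg : Type}
    (P : ClassicalModel (DensityMatrix d) (Measurement d) Outcome Λ Msg) : Prop :=
  ∀ (ρ : DensityMatrix d) (y : Measurement d) (b : Outcome y),
    (P.behavior ρ y b : ℂ) = bornProb ρ y b

/-! ### Bloch vectors -/

abbrev Vec3 : Type := EuclideanSpace ℝ (Fin 3)

/-- The unit sphere in `ℝ³`. -/
abbrev Sphere2 : Type := Metric.sphere (0 : Vec3) 1

/-- The Pauli matrices. -/
def pauli : Fin 3 → Matrix (Fin 2) (Fin 2) ℂ :=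
  ![!![0, 1; 1, 0], !![0, -Complex.I; Complex.I, 0], !![1, 0; 0, -1]]

/-- The coefficient `a` in `A = a 1 + v · σ`. -/
def blochScalar (A : Matrix (Fin 2) (Fin 2) ℂ) : ℝ := A.trace.re / 2

/-- The vector `v` in `A = a 1 + v · σ`. -/
def blochVec (A : Matrix (Fin 2) (Fin 2) ℂ) : Vec3 :=
  WithLp.toLp 2 fun k => (pauli k * A).trace.re / 2

def sgn (s : Bool) : ℝ := if s then 1 else -1

open Classical in
/-- The Bloch vector `± v / ‖v‖` of an eigenstate of `A = a 1 + v · σ`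
(an arbitrary axis if `v = 0`). -/
def eigDir (A : Matrix (Fin 2) (Fin 2) ℂ) (s : Bool) : Vec3 :=
  sgn s • (if blochVec A = 0 then !₂[0, 0, 1] else ‖blochVec A‖⁻¹ • blochVec A)

/-- The corresponding eigenvalue `a ± ‖v‖` of `A = a 1 + v · σ`, so that
`A = ∑_s eigVal A s • (1 + eigDir A s · σ) / 2` for Hermitian `A`. -/
def eigVal (A : Matrix (Fin 2) (Fin 2) ℂ) (s : Bool) : ℝ :=
  blochScalar A + sgn s * ‖blochVec A‖

/-! ### The variable-length code -/

/-- A digit of a message is either a bit or a trit. -/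
abbrev Digit : Type := Fin 2 ⊕ Fin 3

abbrev bit (i : Fin 2) : Digit := Sum.inl i

abbrev trit (i : Fin 3) : Digit := Sum.inr i

/-- Messages are finite sequences of bits and trits. -/
abbrev Word : Type := List Digit

/-- A bit has length `1`, a trit has length `log₂ 3`. -/
def digitLength : Digit → ℝ
  | Sum.inl _ => 1
  | Sum.inr _ => Real.logb 2 3

def wordLength (w : Word) : ℝ := (w.map digitLength).sum

/-- The step function: `Θ z = 1` (`true`) if `0 ≤ z` and `Θ z = 0` (`false`) otherwise. -/
def stepBit (z : ℝ) : Bool := decide (0 ≤ z)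

/-- The pair `(i, j)` with `x ∈ S_{ij}(l₁, l₂)`. -/
def regionIndex (l : Sphere2 × Sphere2) (x : Vec3) : Bool × Bool :=
  (stepBit (inner ℝ x (l.1 : Vec3)), stepBit (inner ℝ x (l.2 : Vec3)))

def codeAPlus : Bool × Bool → Word
  | (false, false) => [bit 0]
  | (true, true) => [bit 1, bit 0]
  | (false, true) => [bit 1, bit 1, bit 0]
  | (true, false) => [bit 1, bit 1, bit 1]

def codeBPlus : Bool × Bool → Word
  | (false, false) => [trit 0]
  | (true, true) => [trit 1]
  | (false, true) => [trit 2, bit 0]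
  | (true, false) => [trit 2, bit 1]

def codeC : Bool × Bool → Word
  | (false, false) => [bit 0, bit 0]
  | (true, true) => [bit 1, bit 1]
  | (false, true) => [bit 0, bit 1]
  | (true, false) => [bit 1, bit 0]

def codeBMinus : Bool × Bool → Word
  | (false, false) => [trit 2, bit 1]
  | (true, true) => [trit 2, bit 0]
  | (false, true) => [trit 1]
  | (true, false) => [trit 0]

def codeAMinus : Bool × Bool → Word
  | (false, false) => [bit 1, bit 1, bit 1]
  | (true, true) => [bit 1, bit 1, bit 0]
  | (false, true) => [bit 1, bit 0]
  | (true, false) => [bit 0]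

/-- The parameter `β ∈ [1, 2]` with `∡(l₁, l₂) = π log₂ β`. -/
def angleParam (l : Sphere2 × Sphere2) : ℝ :=
  (2 : ℝ) ^ (InnerProductGeometry.angle (l.1 : Vec3) (l.2 : Vec3) / Real.pi)

/-- The codeword for the region `S_{ij}`, depending on the shared vectors through their angle. -/
def codeword (l : Sphere2 × Sphere2) : Bool × Bool → Word :=
  if angleParam l ≤ 9 / 8 then codeAPlus
  else if angleParam l ≤ 4 / 3 then codeBPlus
  else if angleParam l < 3 / 2 then codeC
  else if angleParam l < 16 / 9 then codeBMinus
  else codeAMinus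

/-- Bob reads off the region from the codeword; words outside the code never occur. -/
def decodeWord (l : Sphere2 × Sphere2) (w : Word) : Bool × Bool :=
  if w = codeword l (false, false) then (false, false)
  else if w = codeword l (false, true) then (false, true)
  else if w = codeword l (true, false) then (true, false)
  else (true, true)

/-! ### The protocol -/

/-- The uniform probability measure on the sphere. -/
def uniformSphere : Measure Sphere2 :=
  ((volume : Measure Vec3).toSphere Set.univ)⁻¹ • (volume : Measure Vec3).toSphere

/-- Alice draws one of the two eigenstates of `ρ` with its eigenvalue as probability and sends the
codeword of the region of its Bloch vector; in particular, for a pure state with Bloch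
vector `x`, she sends the codeword of the region of `x` with probability one. -/
def aliceProb (ρ : DensityMatrix 2) (l : Sphere2 × Sphere2) (c : Word) : ℝ :=
  ∑ s : Bool, eigVal ρ.1 s *
    (if c = codeword l (regionIndex l (eigDir ρ.1 s)) then 1 else 0)

/-- The weight `p` of the piece `p (1 + y · σ)` in the decomposition of `M_b` into two
(possibly vanishing) multiples of rank-one projectors. -/
def pieceWeight {n : ℕ} (M : POVM 2 n) (k : Fin n × Bool) : ℝ := eigVal (M.1 k.1) k.2 / 2

/-- The unit vector `y` of the piece `p (1 + y · σ)`. -/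
def pieceDir {n : ℕ} (M : POVM 2 n) (k : Fin n × Bool) : Vec3 := eigDir (M.1 k.1) k.2

/-- Bob outputs the piece `k` with probability proportional to `p_k max(0, y_k · m)`
(with a convention in the degenerate case, which has probability zero). -/
def pieceProb {n : ℕ} (M : POVM 2 n) (m : Vec3) (k : Fin n × Bool) : ℝ :=
  if ∑ j, pieceWeight M j * max 0 (inner ℝ (pieceDir M j) m) = 0 then pieceWeight M k
  else pieceWeight M k * max 0 (inner ℝ (pieceDir M k) m) /
    ∑ j, pieceWeight M j * max 0 (inner ℝ (pieceDir M j) m)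

/-- Bob flips `l` if the bit sent for it is `0`. -/
def flipVec (c : Bool) (l : Sphere2) : Vec3 := sgn c • (l : Vec3)

/-- Among the two flipped vectors, Bob keeps the one with the larger overlap with `y`. -/
def chosen (l : Sphere2 × Sphere2) (c : Bool × Bool) (y : Vec3) : Vec3 :=
  if |inner ℝ (flipVec c.2 l.2) y| ≤ |inner ℝ (flipVec c.1 l.1) y| then flipVec c.1 l.1
  else flipVec c.2 l.2

/-- Bob decodes the message, draws a piece `k` of the POVM with probability `p_k`, keeps the flipped
vector `m` with the larger overlap with `y_k`, and draws the outcome according to `m`. -/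
def bobProb (y : Measurement 2) (l : Sphere2 × Sphere2) (w : Word) (b : Outcome y) : ℝ :=
  ∑ k : Fin y.1 × Bool, pieceWeight y.2 k *
    ∑ s : Bool, pieceProb y.2 (chosen l (decodeWord l w) (pieceDir y.2 k)) (b, s)

/-- The qubit protocol with re-encoded messages. -/
def qubitProtocol :
    ClassicalModel (DensityMatrix 2) (Measurement 2) Outcome (Sphere2 × Sphere2) Word where
  law := uniformSphere.prod uniformSphere
  alice := aliceProb
  bob := bobProb
  length := wordLength

/-- The value of the average communication cost. -/
def averageCost : ℝ :=
  3 / 2 - Real.sin (Real.pi * Real.logb 2 3) / Real.pi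
    - Real.sin (2 * Real.pi * Real.logb 2 3) / (2 * Real.pi)

end PrepareMeasure

end

namespace PrepareMeasure

/-! Simulation. Fix a pure state with Bloch vector `x`. Decoding hands Bob the two shared vectors
flipped into the closed hemisphere around `x`. By Archimedes' hat-box theorem `|y · l|` is uniform
on `[0, 1]` for uniform `l`, so one shared vector beats the other in overlap with `y` with
probability equal to its own overlap. Hence the chosen vector `m` is a uniform vector flipped
towards `x`, reweighted by `2 |y · l|` (`integral_chosen`). Drawing `y = y_k` with weight `p_k`
turns the density into `2 ∑ p_k |y_k · m|`. Because `∑ p_k y_k = 0`, this is four times the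
denominator of Bob's second draw, which therefore cancels (`sum_mul_pieceProb`). What is left is `4
p max(0, y · m)`, whose mean is `p (1 + x · y)` (`integral_max_inner_flipToward`). Summing the two
spectral pieces of `M_b` gives Born's rule for pure states, and averaging over the eigenstates of
`ρ` gives it for mixed ones.

Cost. Codewords depend on the shared vectors only through their angle and on `x` only through signs
of inner products, so by rotation invariance every pure state has the same mean cost, and hence so
has every mixed one. It may be averaged over `x` as well; at a fixed angle `π u` the regions have
measures `(1 - u)/2` and `u/2`, two of each, and the mean length is piecewise affine in `u`
(`meanLength_eq_ite`). The angle has density `sin α / 2`, which leaves five elementary integrals.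

The remaining claims are finite checks on the five codes, using that `log₂ 3` lies between `84/53`
and `65/41`. -/

/-! ### Spherical coordinates -/

/-- The point of the unit sphere with polar angle `α` (measured from the zeroth coordinate axis)
and azimuth `φ`. -/
noncomputable def sphericalPoint (α φ : ℝ) : Vec3 :=
  !₂[Real.cos α, Real.sin α * Real.cos φ, Real.sin α * Real.sin φ]

theorem norm_sphericalPoint (α φ : ℝ) : ‖sphericalPoint α φ‖ = 1 := by
  have h : ‖sphericalPoint α φ‖ ^ 2 = 1 := by
    rw [EuclideanSpace.norm_sq_eq, Fin.sum_univ_three]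
    simp only [sphericalPoint, Real.norm_eq_abs, sq_abs, PiLp.toLp_apply, Matrix.cons_val]
    nlinarith [Real.sin_sq_add_cos_sq α, Real.sin_sq_add_cos_sq φ]
  nlinarith [norm_nonneg (sphericalPoint α φ)]

theorem measurable_sphericalPoint :
    Measurable fun p : ℝ × ℝ => sphericalPoint p.1 p.2 := by
  refine (WithLp.measurable_toLp 2 _).comp (measurable_pi_iff.2 fun i => ?_)
  fin_cases i
  · exact Real.measurable_cos.comp measurable_fst
  · exact (Real.measurable_sin.comp measurable_fst).mul (Real.measurable_cos.comp measurable_snd)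
  · exact (Real.measurable_sin.comp measurable_fst).mul (Real.measurable_sin.comp measurable_snd)

theorem measurable_vec3_mk {β : Type*} [MeasurableSpace β] {f g h : β → ℝ} (hf : Measurable f)
    (hg : Measurable g) (hh : Measurable h) : Measurable fun b => (!₂[f b, g b, h b] : Vec3) := by
  refine (WithLp.measurable_toLp 2 _).comp (measurable_pi_iff.2 fun i => ?_)
  fin_cases i
  exacts [hf, hg, hh]

theorem lintegral_vec3_eq {f : Vec3 → ENNReal} (hf : Measurable f) :
    ∫⁻ p, f p = ∫⁻ z : ℝ, ∫⁻ w : ℝ × ℝ, f !₂[z, w.1, w.2] := by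
  have h1 := (PiLp.volume_preserving_toLp (Fin 3)).lintegral_comp hf
  have e2 := (volume_preserving_piFinSuccAbove (fun _ : Fin 3 => ℝ) 0).symm
  have h2 := e2.lintegral_comp (hf.comp (WithLp.measurable_toLp 2 _))
  rw [← h1]
  refine h2.symm.trans ?_
  rw [Measure.volume_eq_prod, lintegral_prod]
  · refine lintegral_congr fun z => ?_
    have e3 := (volume_preserving_finTwoArrow ℝ).symm
    refine (e3.lintegral_comp_emb (MeasurableEquiv.measurableEmbedding _) _).symm.trans ?_
    refine lintegral_congr fun w => ?_
    simp only [Function.comp]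
    congr 2
    ext i
    fin_cases i <;> rfl
  · exact ((hf.comp (WithLp.measurable_toLp 2 _)).comp e2.measurable).aemeasurable

theorem lintegral_prod_eq_polar {f : ℝ × ℝ → ENNReal} (hf : Measurable f) :
    ∫⁻ w, f w = ∫⁻ r in Set.Ioi (0 : ℝ), ∫⁻ φ in Set.Ioo (-Real.pi) Real.pi,
      ENNReal.ofReal r * f (r * Real.cos φ, r * Real.sin φ) := by
  rw [← lintegral_comp_polarCoord_symm, polarCoord_target, Measure.volume_eq_prod,
    ← Measure.prod_restrict, lintegral_prod]
  · rfl
  · refine Measurable.aemeasurable ?_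
    exact (ENNReal.measurable_ofReal.comp measurable_fst).smul
      (hf.comp continuous_polarCoord_symm.measurable)

/-- Polar coordinates twice: in the plane of the last two coordinates, with radius `r` and azimuth
`φ`, then in the half-plane of pairs `(z, r)` with `0 < r`. Substituting `r = ρ sin α` into the
product of Jacobians `ρ * r` gives `ρ ^ 2 * sin α`. -/
theorem lintegral_vec3_eq_spherical {f : Vec3 → ENNReal} (hf : Measurable f) :
    ∫⁻ p, f p = ∫⁻ ρ in Set.Ioi (0 : ℝ), ∫⁻ α in Set.Ioo 0 Real.pi,
      ∫⁻ φ in Set.Ioo (-Real.pi) Real.pi,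
        ENNReal.ofReal (ρ ^ 2 * Real.sin α) * f (ρ • sphericalPoint α φ) := by
  set G : ℝ × ℝ → ENNReal := fun q => ∫⁻ φ in Set.Ioo (-Real.pi) Real.pi,
    ENNReal.ofReal q.2 * f !₂[q.1, q.2 * Real.cos φ, q.2 * Real.sin φ] with hG
  have hGm : Measurable G := by
    refine Measurable.lintegral_prod_right' (f := fun p : (ℝ × ℝ) × ℝ =>
      ENNReal.ofReal p.1.2 * f !₂[p.1.1, p.1.2 * Real.cos p.2, p.1.2 * Real.sin p.2]) ?_
    refine (by fun_prop : Measurable fun p : (ℝ × ℝ) × ℝ => ENNReal.ofReal p.1.2).mul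
      (hf.comp (measurable_vec3_mk ?_ ?_ ?_)) <;> fun_prop
  have hS : MeasurableSet {q : ℝ × ℝ | 0 < q.2} := measurableSet_lt measurable_const measurable_snd
  calc ∫⁻ p, f p = ∫⁻ z : ℝ, ∫⁻ r : ℝ, {q : ℝ × ℝ | 0 < q.2}.indicator G (z, r) := by
        rw [lintegral_vec3_eq hf]
        refine lintegral_congr fun z => ?_
        rw [lintegral_prod_eq_polar (f := fun w => f !₂[z, w.1, w.2])]
        · rw [← lintegral_indicator measurableSet_Ioi]
          rfl
        · exact hf.comp (measurable_vec3_mk (by fun_prop) (by fun_prop) (by fun_prop))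
    _ = ∫⁻ q : ℝ × ℝ, {q : ℝ × ℝ | 0 < q.2}.indicator G q := by
        rw [Measure.volume_eq_prod, lintegral_prod _ (hGm.indicator hS).aemeasurable]
    _ = _ := by
        rw [lintegral_prod_eq_polar (hGm.indicator hS)]
        refine setLIntegral_congr_fun measurableSet_Ioi fun ρ (hρ : 0 < ρ) => ?_
        -- The second polar angle runs over `(-π, π)`; the indicator of `0 < r` cuts it down to `(0,
        -- π)`.
        have hsub : Set.Ioo (-Real.pi) Real.pi ∩ Set.Ioo 0 Real.pi = Set.Ioo 0 Real.pi :=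
          Set.inter_eq_right.2 (Set.Ioo_subset_Ioo_left (by linarith [Real.pi_pos]))
        beta_reduce
        rw [← hsub, Set.inter_comm, ← setLIntegral_indicator measurableSet_Ioo]
        refine setLIntegral_congr_fun measurableSet_Ioo fun α hα => ?_
        by_cases h : 0 < α
        · have hs : 0 < Real.sin α := Real.sin_pos_of_pos_of_lt_pi h hα.2
          rw [Set.indicator_of_mem (show (ρ * Real.cos α, ρ * Real.sin α) ∈ {q : ℝ × ℝ | 0 < q.2}
            from mul_pos hρ hs), Set.indicator_of_mem (show α ∈ Set.Ioo 0 Real.pi from ⟨h, hα.2⟩)]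
          rw [hG, ← lintegral_const_mul]
          · refine lintegral_congr fun φ => ?_
            rw [← mul_assoc, ← ENNReal.ofReal_mul hρ.le]
            congr 2
            · ring
            · ext i
              fin_cases i <;> simp [sphericalPoint, mul_assoc]
          · refine Measurable.mul measurable_const
              (hf.comp (measurable_vec3_mk ?_ ?_ ?_)) <;> fun_prop
        · have hs : Real.sin α ≤ 0 :=
            Real.sin_nonpos_of_nonpos_of_neg_pi_le (not_lt.1 h) hα.1.le
          rw [Set.indicator_of_notMem (show (ρ * Real.cos α, ρ * Real.sin α) ∉
              {q : ℝ × ℝ | 0 < q.2} from not_lt.2 (mul_nonpos_of_nonneg_of_nonpos hρ.le hs)),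
            Set.indicator_of_notMem (fun h' => h h'.1), mul_zero]

/-! ### The uniform measure on the sphere -/

open scoped Pointwise in
theorem toSphere_preimage_coe {A : Set Vec3} (hA : MeasurableSet A) :
    (volume : Measure Vec3).toSphere ((↑) ⁻¹' A : Set Sphere2) =
      3 * volume {p : Vec3 | ‖p‖ ∈ Set.Ioo (0 : ℝ) 1 ∧ ‖p‖⁻¹ • p ∈ A} := by
  have hset : Set.Ioo (0 : ℝ) 1 • ((↑) '' ((↑) ⁻¹' A : Set Sphere2) : Set Vec3) =
      {p : Vec3 | ‖p‖ ∈ Set.Ioo (0 : ℝ) 1 ∧ ‖p‖⁻¹ • p ∈ A} := by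
    ext p
    constructor
    · rintro ⟨r, hr, _, ⟨v, hv, rfl⟩, rfl⟩
      have hn : ‖r • (v : Vec3)‖ = r := by
        rw [norm_smul, norm_eq_of_mem_sphere, mul_one, Real.norm_of_nonneg hr.1.le]
      refine ⟨?_, ?_⟩ <;> dsimp only <;> rw [hn]
      · exact hr
      · rwa [smul_smul, inv_mul_cancel₀ hr.1.ne', one_smul]
    · rintro ⟨hp, hA⟩
      refine ⟨‖p‖, hp, ‖p‖⁻¹ • p, ⟨⟨‖p‖⁻¹ • p, ?_⟩, hA, rfl⟩, ?_⟩
      · rw [mem_sphere_zero_iff_norm, norm_smul, norm_inv, norm_norm, inv_mul_cancel₀ hp.1.ne']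
      · simp only
        rw [smul_smul, mul_inv_cancel₀ hp.1.ne', one_smul]
  rw [Measure.toSphere_apply' _ (measurable_subtype_coe hA), hset, finrank_euclideanSpace_fin]
  rfl

/-- The cone over `A` is a product set in spherical coordinates, and the radial factor `∫₀¹ ρ²`
cancels the dimension factor `3`. -/
theorem toSphere_apply_eq_spherical {A : Set Vec3} (hA : MeasurableSet A) :
    (volume : Measure Vec3).toSphere ((↑) ⁻¹' A : Set Sphere2) =
      ∫⁻ α in Set.Ioo 0 Real.pi, ENNReal.ofReal (Real.sin α) *
        volume {φ ∈ Set.Ioo (-Real.pi) Real.pi | sphericalPoint α φ ∈ A} := by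
  have hm : MeasurableSet {p : Vec3 | ‖p‖ ∈ Set.Ioo (0 : ℝ) 1 ∧ ‖p‖⁻¹ • p ∈ A} :=
    (measurable_norm measurableSet_Ioo).inter
      ((measurable_norm.inv.smul measurable_id) hA)
  rw [toSphere_preimage_coe hA, ← lintegral_indicator_one hm,
    lintegral_vec3_eq_spherical (measurable_one.indicator hm)]
  have hmeas : ∀ α, MeasurableSet {φ | sphericalPoint α φ ∈ A} := fun α =>
    (measurable_sphericalPoint.comp (measurable_const.prodMk measurable_id)) hA
  have key : ∀ ρ ∈ Set.Ioi (0 : ℝ), (∫⁻ α in Set.Ioo 0 Real.pi, ∫⁻ φ in Set.Ioo (-Real.pi) Real.pi,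
      ENNReal.ofReal (ρ ^ 2 * Real.sin α) *
        {p : Vec3 | ‖p‖ ∈ Set.Ioo (0 : ℝ) 1 ∧ ‖p‖⁻¹ • p ∈ A}.indicator 1
          (ρ • sphericalPoint α φ)) =
      (Set.Iio (1 : ℝ)).indicator (fun ρ => ENNReal.ofReal (ρ ^ 2)) ρ *
        ∫⁻ α in Set.Ioo 0 Real.pi, ENNReal.ofReal (Real.sin α) *
          volume {φ ∈ Set.Ioo (-Real.pi) Real.pi | sphericalPoint α φ ∈ A} := by
    intro ρ hρ
    have hn : ∀ α φ, ‖ρ • sphericalPoint α φ‖ = ρ := fun α φ => by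
      rw [norm_smul, norm_sphericalPoint, mul_one, Real.norm_of_nonneg hρ.le]
    rw [← lintegral_const_mul']
    · refine lintegral_congr fun α => ?_
      have : ∀ φ, ENNReal.ofReal (ρ ^ 2 * Real.sin α) *
          {p : Vec3 | ‖p‖ ∈ Set.Ioo (0 : ℝ) 1 ∧ ‖p‖⁻¹ • p ∈ A}.indicator 1
          (ρ • sphericalPoint α φ) = (Set.Iio (1 : ℝ)).indicator (fun ρ => ENNReal.ofReal (ρ ^ 2)) ρ
            * ENNReal.ofReal (Real.sin α) * {φ | sphericalPoint α φ ∈ A}.indicator 1 φ := by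
        intro φ
        have hiff : ρ • sphericalPoint α φ ∈ {p : Vec3 | ‖p‖ ∈ Set.Ioo (0 : ℝ) 1 ∧ ‖p‖⁻¹ • p ∈ A} ↔
            ρ < 1 ∧ sphericalPoint α φ ∈ A := by
          rw [Set.mem_ofPred_eq, hn, smul_smul, inv_mul_cancel₀ (show (0 : ℝ) < ρ from hρ).ne',
            one_smul]
          exact and_congr_left fun _ => and_iff_right hρ
        rw [ENNReal.ofReal_mul (sq_nonneg ρ)]
        by_cases h1 : ρ < 1 <;> by_cases h2 : sphericalPoint α φ ∈ A <;>
          simp only [Set.indicator, hiff, h1, h2] <;> simp [h1, h2]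
      rw [lintegral_congr this, lintegral_const_mul _ (measurable_one.indicator (hmeas α)),
        lintegral_indicator_one (hmeas α), Measure.restrict_apply (hmeas α), mul_assoc,
        Set.inter_comm]
      rfl
    · simp only [Set.indicator]
      split_ifs <;> simp
  rw [setLIntegral_congr_fun measurableSet_Ioi key, lintegral_mul_const, ← mul_assoc]
  · rw [setLIntegral_indicator measurableSet_Iio, Set.inter_comm, Set.Ioi_inter_Iio,
      restrict_Ioo_eq_restrict_Ioc,
      ← ofReal_integral_eq_lintegral_ofReal
        (intervalIntegral.intervalIntegrable_pow 2).1
        (Filter.Eventually.of_forall fun x => sq_nonneg x),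
      ← intervalIntegral.integral_of_le zero_le_one, integral_pow]
    rw [show (3 : ENNReal) = ENNReal.ofReal 3 by simp, ← ENNReal.ofReal_mul (by positivity)]
    norm_num
  · exact (ENNReal.measurable_ofReal.comp (measurable_id.pow_const 2)).indicator measurableSet_Iio

theorem lintegral_ofReal_sin : ∫⁻ α in Set.Ioo 0 Real.pi, ENNReal.ofReal (Real.sin α) = 2 := by
  rw [restrict_Ioo_eq_restrict_Ioc, ← ofReal_integral_eq_lintegral_ofReal
      Real.continuous_sin.integrableOn_Ioc,
    ← intervalIntegral.integral_of_le Real.pi_pos.le, integral_sin]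
  · norm_num
  · filter_upwards [ae_restrict_mem measurableSet_Ioc] with α hα
    exact Real.sin_nonneg_of_nonneg_of_le_pi hα.1.le hα.2

theorem toSphere_univ_eq : (volume : Measure Vec3).toSphere Set.univ =
    ENNReal.ofReal (4 * Real.pi) := by
  have h := toSphere_apply_eq_spherical MeasurableSet.univ
  simp only [Set.preimage_univ, Set.mem_univ, and_true, Set.ofPred_mem_eq, Real.volume_Ioo] at h
  rw [h, lintegral_mul_const _ (by fun_prop), lintegral_ofReal_sin,
    show (2 : ENNReal) = ENNReal.ofReal 2 by simp, ← ENNReal.ofReal_mul (by norm_num)]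
  ring_nf

theorem uniformSphere_apply_eq_spherical {A : Set Vec3} (hA : MeasurableSet A) :
    uniformSphere ((↑) ⁻¹' A) = (ENNReal.ofReal (4 * Real.pi))⁻¹ *
      ∫⁻ α in Set.Ioo 0 Real.pi, ENNReal.ofReal (Real.sin α) *
        volume {φ ∈ Set.Ioo (-Real.pi) Real.pi | sphericalPoint α φ ∈ A} := by
  rw [uniformSphere, Measure.smul_apply, toSphere_univ_eq, toSphere_apply_eq_spherical hA,
    smul_eq_mul]

instance : IsProbabilityMeasure uniformSphere := by
  refine ⟨?_⟩
  rw [uniformSphere, Measure.smul_apply, smul_eq_mul, ENNReal.inv_mul_cancel]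
  · rw [toSphere_univ_eq]
    simp [Real.pi_pos]
  · exact measure_ne_top _ _

/-! ### Invariance under isometries -/

/-- The action of a linear isometry on the unit sphere. -/
noncomputable def sphereMap (R : Vec3 ≃ₗᵢ[ℝ] Vec3) (v : Sphere2) : Sphere2 :=
  ⟨R v, by rw [mem_sphere_zero_iff_norm, R.norm_map, norm_eq_of_mem_sphere]⟩

@[simp]
theorem coe_sphereMap (R : Vec3 ≃ₗᵢ[ℝ] Vec3) (v : Sphere2) : (sphereMap R v : Vec3) = R v := rfl

theorem measurable_sphereMap (R : Vec3 ≃ₗᵢ[ℝ] Vec3) : Measurable (sphereMap R) :=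
  (R.continuous.measurable.comp measurable_subtype_coe).subtype_mk

/-- The measure of a set is a multiple of the volume of the cone over it; an isometry preserves
volume and commutes with normalisation. -/
theorem measurePreserving_sphereMap (R : Vec3 ≃ₗᵢ[ℝ] Vec3) :
    MeasurePreserving (sphereMap R) uniformSphere uniformSphere := by
  refine ⟨measurable_sphereMap R, Measure.ext fun s hs => ?_⟩
  obtain ⟨A, hA, rfl⟩ := hs
  have hm : MeasurableSet {p : Vec3 | ‖p‖ ∈ Set.Ioo (0 : ℝ) 1 ∧ ‖p‖⁻¹ • p ∈ A} :=
    (measurable_norm measurableSet_Ioo).inter ((measurable_norm.inv.smul measurable_id) hA)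
  rw [Measure.map_apply (measurable_sphereMap R) (measurable_subtype_coe hA)]
  have h1 : sphereMap R ⁻¹' ((↑) ⁻¹' A) = (↑) ⁻¹' (R ⁻¹' A) := rfl
  rw [h1, uniformSphere, Measure.smul_apply, Measure.smul_apply,
    toSphere_preimage_coe (R.continuous.measurable hA), toSphere_preimage_coe hA,
    ← R.measurePreserving.measure_preimage hm.nullMeasurableSet]
  congr 3
  ext p
  simp

theorem exists_isometry_map_eq {a b : Vec3} (h : ‖a‖ = ‖b‖) :
    ∃ R : Vec3 ≃ₗᵢ[ℝ] Vec3, R a = b :=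
  ⟨(ℝ ∙ (a - b))ᗮ.reflection, Submodule.reflection_sub h⟩

/-- After `a` has been moved to `a'`, the reflection swapping `R b` and `b'` fixes `a'`, since
equality of the inner products makes `R b - b'` orthogonal to `a'`. -/
theorem exists_isometry_map_pair_eq {a b a' b' : Vec3} (ha : ‖a‖ = ‖a'‖) (hb : ‖b‖ = ‖b'‖)
    (hab : inner ℝ a b = inner ℝ a' b') : ∃ R : Vec3 ≃ₗᵢ[ℝ] Vec3, R a = a' ∧ R b = b' := by
  obtain ⟨R, hR⟩ := exists_isometry_map_eq ha
  refine ⟨R.trans (ℝ ∙ (R b - b'))ᗮ.reflection, ?_, ?_⟩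
  · rw [LinearIsometryEquiv.trans_apply, hR]
    refine Submodule.reflection_mem_subspace_eq_self ?_
    rw [Submodule.mem_orthogonal_singleton_iff_inner_left, inner_sub_right, ← hab, ← hR,
      R.inner_map_map, sub_self]
  · rw [LinearIsometryEquiv.trans_apply]
    exact Submodule.reflection_sub (by rw [R.norm_map, hb])

/-! ### The law of one coordinate -/

theorem measurable_inner_coe (x : Vec3) : Measurable fun l : Sphere2 => inner ℝ x (l : Vec3) :=
  (measurable_const.inner measurable_subtype_coe)

/-- Rotate `x` to the polar axis. Keeping the law as an image under `cos` of a density in the polar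
angle serves both the overlaps and the angle between the shared vectors. -/
theorem uniformSphere_map_inner {x : Vec3} (hx : ‖x‖ = 1) :
    uniformSphere.map (fun l : Sphere2 => inner ℝ x (l : Vec3)) =
      ((volume.restrict (Set.Icc 0 Real.pi)).withDensity
        fun α => ENNReal.ofReal (Real.sin α / 2)).map Real.cos := by
  obtain ⟨R, hR⟩ := exists_isometry_map_eq (a := x) (b := !₂[1, 0, 0])
    (by rw [hx, EuclideanSpace.norm_eq]; simp [Fin.sum_univ_three])
  refine Measure.ext fun A hA => ?_
  rw [Measure.map_apply (measurable_inner_coe x) hA, Measure.map_apply Real.measurable_cos hA,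
    withDensity_apply _ (Real.measurable_cos hA)]
  have h1 : (fun l : Sphere2 => inner ℝ x (l : Vec3)) ⁻¹' A =
      sphereMap R ⁻¹' ((↑) ⁻¹' {p : Vec3 | p 0 ∈ A}) := by
    ext l
    simp only [Set.mem_preimage, coe_sphereMap, Set.mem_ofPred_eq]
    rw [← R.inner_map_map, hR]
    simp [PiLp.inner_apply, Fin.sum_univ_three]
  have hm : MeasurableSet {p : Vec3 | p 0 ∈ A} :=
    (by fun_prop : Measurable fun p : Vec3 => p 0) hA
  rw [h1, (measurePreserving_sphereMap R).measure_preimage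
    (measurable_subtype_coe hm).nullMeasurableSet, uniformSphere_apply_eq_spherical hm]
  have h2 : ∀ α, ENNReal.ofReal (Real.sin α) *
      volume {φ ∈ Set.Ioo (-Real.pi) Real.pi | sphericalPoint α φ ∈ {p : Vec3 | p 0 ∈ A}} =
      ENNReal.ofReal (4 * Real.pi) *
        (Real.cos ⁻¹' A).indicator (fun α => ENNReal.ofReal (Real.sin α / 2)) α := by
    intro α
    have h4 : ∀ φ, sphericalPoint α φ 0 = Real.cos α := fun φ => rfl
    simp only [Set.mem_ofPred_eq, h4]
    by_cases h : Real.cos α ∈ A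
    · rw [Set.indicator_of_mem (show α ∈ Real.cos ⁻¹' A from h)]
      simp only [h, and_true, Set.ofPred_mem_eq, Real.volume_Ioo]
      rw [mul_comm, ← ENNReal.ofReal_mul (by linarith [Real.pi_pos]),
        ← ENNReal.ofReal_mul (by positivity)]
      ring_nf
    · rw [Set.indicator_of_notMem (show α ∉ Real.cos ⁻¹' A from h)]
      simp [h]
  rw [lintegral_congr h2, lintegral_const_mul, ← mul_assoc, ENNReal.inv_mul_cancel, one_mul,
    lintegral_indicator (Real.measurable_cos hA), Measure.restrict_restrict
      (Real.measurable_cos hA), Measure.restrict_restrict (Real.measurable_cos hA)]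
  · exact setLIntegral_congr (Filter.EventuallyEq.rfl.inter Ioo_ae_eq_Icc)
  · simp [Real.pi_pos]
  · exact ENNReal.ofReal_ne_top
  · exact Measurable.indicator (by fun_prop) (Real.measurable_cos hA)

theorem integral_comp_inner {x : Vec3} (hx : ‖x‖ = 1) {h : ℝ → ℝ} (hh : Measurable h) :
    ∫ l : Sphere2, h (inner ℝ x (l : Vec3)) ∂uniformSphere =
      ∫ α in (0 : ℝ)..Real.pi, h (Real.cos α) * (Real.sin α / 2) := by
  rw [← integral_map (f := h) (measurable_inner_coe x).aemeasurable hh.aestronglyMeasurable,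
    uniformSphere_map_inner hx,
    integral_map Real.measurable_cos.aemeasurable hh.aestronglyMeasurable,
    integral_withDensity_eq_integral_toReal_smul (by fun_prop) (by simp),
    intervalIntegral.integral_of_le Real.pi_pos.le, ← integral_Icc_eq_integral_Ioc]
  refine setIntegral_congr_fun measurableSet_Icc fun α hα => ?_
  have := Real.sin_nonneg_of_nonneg_of_le_pi hα.1 hα.2
  simp only [smul_eq_mul]
  rw [ENNReal.toReal_ofReal (by positivity), mul_comm]

theorem integral_abs_inner {x : Vec3} (hx : ‖x‖ = 1) :
    ∫ l : Sphere2, |inner ℝ x (l : Vec3)| ∂uniformSphere = 1 / 2 := by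
  rw [integral_comp_inner hx (h := fun t => |t|) (by fun_prop)]
  have hc : Continuous fun α => |Real.cos α| * (Real.sin α / 2) := by fun_prop
  have h1 : ∫ α in (0 : ℝ)..(Real.pi / 2), |Real.cos α| * (Real.sin α / 2) = 1 / 4 := by
    have : ∀ α ∈ Set.uIcc 0 (Real.pi / 2), |Real.cos α| * (Real.sin α / 2) =
        (1 / 2) * (Real.sin α * Real.cos α) := by
      intro α hα
      rw [Set.uIcc_of_le (by positivity)] at hα
      rw [abs_of_nonneg (Real.cos_nonneg_of_neg_pi_div_two_le_of_le
        (by linarith [hα.1, Real.pi_pos]) hα.2)]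
      ring
    rw [intervalIntegral.integral_congr this, intervalIntegral.integral_const_mul,
      integral_sin_mul_cos₁]
    norm_num
  have h2 : ∫ α in (Real.pi / 2)..Real.pi, |Real.cos α| * (Real.sin α / 2) = 1 / 4 := by
    have : ∀ α ∈ Set.uIcc (Real.pi / 2) Real.pi, |Real.cos α| * (Real.sin α / 2) =
        (-1 / 2) * (Real.sin α * Real.cos α) := by
      intro α hα
      rw [Set.uIcc_of_le (by linarith [Real.pi_pos])] at hα
      rw [abs_of_nonpos (Real.cos_nonpos_of_pi_div_two_le_of_le hα.1
        (by linarith [hα.2, Real.pi_pos]))]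
      ring
    rw [intervalIntegral.integral_congr this, intervalIntegral.integral_const_mul,
      integral_sin_mul_cos₁]
    norm_num
  rw [← intervalIntegral.integral_add_adjacent_intervals (hc.intervalIntegrable _ _)
    (hc.intervalIntegrable _ _), h1, h2]
  norm_num

theorem integral_indicator_sin_div_two {t : ℝ} (ht : t ∈ Set.Icc (0 : ℝ) 1) :
    ∫ α in Set.Ioc (Real.arccos t) (Real.arccos (-t)), Real.sin α / 2 = t := by
  rw [← intervalIntegral.integral_of_le (Real.arccos_le_arccos (by linarith [ht.1])),
    intervalIntegral.integral_div, integral_sin, Real.cos_arccos (by linarith [ht.1]) ht.2,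
    Real.cos_arccos (by linarith [ht.2]) (by linarith [ht.1])]
  ring

/-- Archimedes' hat-box theorem: the absolute overlap is uniform on `[0, 1]`. -/
theorem uniformSphere_real_abs_inner_le {x : Vec3} (hx : ‖x‖ = 1) {t : ℝ}
    (ht : t ∈ Set.Icc (0 : ℝ) 1) :
    uniformSphere.real {l : Sphere2 | |inner ℝ x (l : Vec3)| ≤ t} = t := by
  have hm : MeasurableSet {u : ℝ | |u| ≤ t} := measurableSet_le measurable_norm measurable_const
  have h1 := integral_comp_inner hx (h := {u : ℝ | |u| ≤ t}.indicator 1)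
    (measurable_one.indicator hm)
  have hm' : MeasurableSet {l : Sphere2 | |inner ℝ x (l : Vec3)| ≤ t} := measurable_inner_coe x hm
  have h2 : (fun l : Sphere2 => {u : ℝ | |u| ≤ t}.indicator (1 : ℝ → ℝ) (inner ℝ x (l : Vec3))) =
    {l : Sphere2 | |inner ℝ x (l : Vec3)| ≤ t}.indicator 1 := rfl
  rw [h2, integral_indicator_one hm'] at h1
  rw [h1, intervalIntegral.integral_of_le Real.pi_pos.le, ← integral_Icc_eq_integral_Ioc]
  have h3 : ∀ α ∈ Set.Icc 0 Real.pi,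
      {u : ℝ | |u| ≤ t}.indicator (1 : ℝ → ℝ) (Real.cos α) * (Real.sin α / 2) =
      (Set.Icc (Real.arccos t) (Real.arccos (-t))).indicator (fun α => Real.sin α / 2) α := by
    intro α hα
    have h5 : |Real.cos α| ≤ t ↔ α ∈ Set.Icc (Real.arccos t) (Real.arccos (-t)) := by
      rw [abs_le, Set.mem_Icc, and_comm]
      conv_rhs => rw [← Real.arccos_cos hα.1 hα.2]
      rw [Real.strictAntiOn_arccos.le_iff_ge ⟨by linarith [ht.1], ht.2⟩
        ⟨Real.neg_one_le_cos α, Real.cos_le_one α⟩, Real.strictAntiOn_arccos.le_iff_ge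
        ⟨Real.neg_one_le_cos α, Real.cos_le_one α⟩ ⟨by linarith [ht.2], by linarith [ht.1]⟩]
    simp only [Set.indicator, Set.mem_ofPred_eq, h5]
    split_ifs <;> simp
  rw [setIntegral_congr_fun measurableSet_Icc h3, setIntegral_indicator measurableSet_Icc,
    Set.inter_eq_right.2 (Set.Icc_subset_Icc (Real.arccos_nonneg _) (Real.arccos_le_pi _)),
    integral_Icc_eq_integral_Ioc, integral_indicator_sin_div_two ht]

/-- The strict form is needed because Bob resolves ties in favour of the first vector. It follows by
letting `s` increase to `t`. -/
theorem uniformSphere_real_abs_inner_lt {x : Vec3} (hx : ‖x‖ = 1) {t : ℝ}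
    (ht : t ∈ Set.Icc (0 : ℝ) 1) :
    uniformSphere.real {l : Sphere2 | |inner ℝ x (l : Vec3)| < t} = t := by
  refine le_antisymm ?_ (le_of_forall_lt_imp_le_of_dense fun s hs => ?_)
  · exact (measureReal_mono (Set.ofPred_subset_ofPred.2 fun _ => le_of_lt)).trans
      (uniformSphere_real_abs_inner_le hx ht).le
  · rcases le_or_gt s 0 with h0 | h0
    · exact h0.trans measureReal_nonneg
    · rw [← uniformSphere_real_abs_inner_le hx ⟨h0.le, hs.le.trans ht.2⟩]
      exact measureReal_mono (Set.ofPred_subset_ofPred.2 fun _ hl => lt_of_le_of_lt hl hs)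

/-! ### The area of a lune -/

theorem volume_cos_nonneg_cos_sub_nonneg {θ : ℝ} (h0 : 0 ≤ θ) (h1 : θ ≤ Real.pi) :
    volume {φ ∈ Set.Ioo (-Real.pi) Real.pi | 0 ≤ Real.cos φ ∧ 0 ≤ Real.cos (φ - θ)} =
      ENNReal.ofReal (Real.pi - θ) := by
  have hpi := Real.pi_pos
  have hcos : ∀ {φ}, φ ∈ Set.Ioo (-Real.pi) Real.pi → 0 ≤ Real.cos φ →
      φ ∈ Set.Icc (-(Real.pi / 2)) (Real.pi / 2) := by
    intro φ hφ h
    constructor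
    · by_contra! h'
      have := Real.cos_neg_of_pi_div_two_lt_of_lt (x := -φ) (by linarith) (by linarith [hφ.1])
      rw [Real.cos_neg] at this
      linarith
    · by_contra! h'
      linarith [Real.cos_neg_of_pi_div_two_lt_of_lt h' (by linarith [hφ.2])]
  rcases h1.lt_or_eq with h1 | rfl
  · have : {φ ∈ Set.Ioo (-Real.pi) Real.pi | 0 ≤ Real.cos φ ∧ 0 ≤ Real.cos (φ - θ)} =
        Set.Icc (θ - Real.pi / 2) (Real.pi / 2) := by
      ext φ
      constructor
      · rintro ⟨hφ, ha, hb⟩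
        have h := hcos hφ ha
        refine ⟨?_, h.2⟩
        by_contra! h'
        have := Real.cos_neg_of_pi_div_two_lt_of_lt (x := -(φ - θ)) (by linarith)
          (by linarith [h.1])
        rw [Real.cos_neg] at this
        linarith
      · rintro ⟨ha, hb⟩
        refine ⟨⟨by linarith, by linarith⟩, ?_, ?_⟩ <;>
        exact Real.cos_nonneg_of_neg_pi_div_two_le_of_le (by linarith) (by linarith)
    rw [this, Real.volume_Icc]
    ring_nf
  -- For opposite vectors the two closed hemispheres meet only in their common boundary.
  · rw [sub_self, ENNReal.ofReal_zero]
    refine measure_mono_null (t := {-(Real.pi / 2), Real.pi / 2}) ?_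
      ((Set.toFinite _).measure_zero _)
    rintro φ ⟨hφ, ha, hb⟩
    rw [Real.cos_sub_pi] at hb
    have h := hcos hφ ha
    by_contra h'
    simp only [Set.mem_insert_iff, Set.mem_singleton_iff, not_or] at h'
    linarith [Real.cos_pos_of_mem_Ioo ⟨lt_of_le_of_ne h.1 (Ne.symm h'.1), lt_of_le_of_ne h.2 h'.2⟩]

/-- Rotate `a` and `b` into the plane orthogonal to the polar axis. As `sin α > 0`, both sign
conditions then concern the azimuth alone and cut out an arc of length `π - θ`. -/
theorem uniformSphere_real_lune (a b : Sphere2) :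
    uniformSphere.real {v : Sphere2 | 0 ≤ inner ℝ (v : Vec3) (a : Vec3) ∧
      0 ≤ inner ℝ (v : Vec3) (b : Vec3)} =
      (Real.pi - InnerProductGeometry.angle (a : Vec3) (b : Vec3)) / (2 * Real.pi) := by
  set θ := InnerProductGeometry.angle (a : Vec3) (b : Vec3) with hθ
  have hθ0 : 0 ≤ θ := InnerProductGeometry.angle_nonneg _ _
  have hθ1 : θ ≤ Real.pi := InnerProductGeometry.angle_le_pi _ _
  have hcos : inner ℝ (a : Vec3) (b : Vec3) = Real.cos θ := by
    rw [hθ, InnerProductGeometry.cos_angle]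
    simp [norm_eq_of_mem_sphere]
  obtain ⟨R, hRa, hRb⟩ := exists_isometry_map_pair_eq (a := a) (b := b) (a' := !₂[0, 1, 0])
    (b' := !₂[0, Real.cos θ, Real.sin θ])
    (by rw [norm_eq_of_mem_sphere, EuclideanSpace.norm_eq]; simp [Fin.sum_univ_three])
    (by rw [norm_eq_of_mem_sphere, EuclideanSpace.norm_eq]; simp [Fin.sum_univ_three])
    (by rw [hcos]; simp [PiLp.inner_apply, Fin.sum_univ_three])
  set A : Set Vec3 := {p | 0 ≤ p 1 ∧ 0 ≤ p 1 * Real.cos θ + p 2 * Real.sin θ} with hA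
  have hm : MeasurableSet A := by
    exact (measurableSet_le measurable_const (by fun_prop : Measurable fun p : Vec3 => p 1)).inter
      (measurableSet_le measurable_const
        (by fun_prop : Measurable fun p : Vec3 => p 1 * Real.cos θ + p 2 * Real.sin θ))
  have h1 : {v : Sphere2 | 0 ≤ inner ℝ (v : Vec3) (a : Vec3) ∧
      0 ≤ inner ℝ (v : Vec3) (b : Vec3)} = sphereMap R ⁻¹' ((↑) ⁻¹' A) := by
    ext v
    simp only [Set.mem_preimage, coe_sphereMap, hA, Set.mem_ofPred_eq]
    rw [← R.inner_map_map v a, ← R.inner_map_map v b, hRa, hRb]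
    simp [PiLp.inner_apply, Fin.sum_univ_three, mul_comm]
  rw [measureReal_def, h1, (measurePreserving_sphereMap R).measure_preimage
    (measurable_subtype_coe hm).nullMeasurableSet, uniformSphere_apply_eq_spherical hm]
  have h2 : ∀ α ∈ Set.Ioo 0 Real.pi, ENNReal.ofReal (Real.sin α) *
      volume {φ ∈ Set.Ioo (-Real.pi) Real.pi | sphericalPoint α φ ∈ A} =
      ENNReal.ofReal (Real.sin α) * ENNReal.ofReal (Real.pi - θ) := by
    intro α hα
    have hs := Real.sin_pos_of_pos_of_lt_pi hα.1 hα.2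
    rw [← volume_cos_nonneg_cos_sub_nonneg hθ0 hθ1]
    congr 3
    ext φ
    refine and_congr_right fun _ => ?_
    have e1 : sphericalPoint α φ 1 = Real.sin α * Real.cos φ := rfl
    have e2 : sphericalPoint α φ 2 = Real.sin α * Real.sin φ := rfl
    rw [hA, Set.mem_ofPred_eq, e1, e2, Real.cos_sub]
    rw [show Real.sin α * Real.cos φ * Real.cos θ + Real.sin α * Real.sin φ * Real.sin θ =
      Real.sin α * (Real.cos φ * Real.cos θ + Real.sin φ * Real.sin θ) by ring,
      mul_nonneg_iff_of_pos_left hs, mul_nonneg_iff_of_pos_left hs]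
  rw [setLIntegral_congr_fun measurableSet_Ioo h2, lintegral_mul_const _ (by fun_prop),
    lintegral_ofReal_sin, ENNReal.toReal_mul, ENNReal.toReal_inv, ENNReal.toReal_mul,
    ENNReal.toReal_ofReal (by positivity), ENNReal.toReal_ofReal (by linarith)]
  simp only [ENNReal.toReal_ofNat]
  field_simp
  norm_num

/-! ### Bloch vectors of Hermitian matrices -/

theorem norm_eigDir (A : Matrix (Fin 2) (Fin 2) ℂ) (s : Bool) : ‖eigDir A s‖ = 1 := by
  have hs : ‖sgn s‖ = 1 := by cases s <;> simp [sgn]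
  rw [eigDir, norm_smul, hs, one_mul]
  split_ifs with h
  · rw [EuclideanSpace.norm_eq]
    simp [Fin.sum_univ_three]
  · rw [norm_smul, norm_inv, norm_norm, inv_mul_cancel₀ (norm_ne_zero_iff.2 h)]

theorem sum_eigVal (A : Matrix (Fin 2) (Fin 2) ℂ) : ∑ s : Bool, eigVal A s = A.trace.re := by
  simp [eigVal, sgn, blochScalar]
  ring

/-- If the Bloch vector vanishes, both eigenvalues coincide and the arbitrary opposite directions
cancel. -/
theorem sum_eigVal_smul_eigDir (A : Matrix (Fin 2) (Fin 2) ℂ) :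
    ∑ s : Bool, eigVal A s • eigDir A s = (2 : ℝ) • blochVec A := by
  rw [Fintype.sum_bool]
  by_cases h : blochVec A = 0
  · simp [eigVal, eigDir, sgn, h]
  · have h' : ‖blochVec A‖ ≠ 0 := norm_ne_zero_iff.2 h
    simp only [eigVal, eigDir, sgn, h, if_true, if_false, Bool.false_eq_true, smul_smul, ← add_smul]
    congr 1
    field_simp
    ring

/-- The determinant is `a² - ‖v‖²` and the trace is `2 a`; both being nonnegative forces `‖v‖ ≤ a`.
-/
theorem eigVal_nonneg {A : Matrix (Fin 2) (Fin 2) ℂ} (hA : A.PosSemidef) (s : Bool) :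
    0 ≤ eigVal A s := by
  have ht := (Complex.le_def.1 hA.trace_nonneg).1
  have hd := (Complex.le_def.1 hA.det_nonneg).1
  have h01 := hA.isHermitian.apply 0 1
  have h00 := congrArg Complex.im (hA.isHermitian.apply 0 0)
  have h11 := congrArg Complex.im (hA.isHermitian.apply 1 1)
  have hre := congrArg Complex.re h01
  have him := congrArg Complex.im h01
  simp only [RCLike.star_def, Complex.conj_re, Complex.conj_im] at h00 h11 hre him
  have h0 : (A 0 0).im = 0 := by linarith
  have h1 : (A 1 1).im = 0 := by linarith
  rw [Matrix.trace_fin_two] at ht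
  rw [Matrix.det_fin_two] at hd
  simp [h0, h1] at ht hd
  have hn : ‖blochVec A‖ ≤ blochScalar A := by
    refine abs_le_of_sq_le_sq' ?_ ?_ |>.2
    · rw [EuclideanSpace.norm_sq_eq, Fin.sum_univ_three]
      simp [blochVec, pauli, Matrix.trace_fin_two, Matrix.mul_apply, blochScalar]
      rw [hre, ← him]
      rw [hre, ← him] at hd
      simp only [div_pow, sq_abs]
      linarith
    · simp only [blochScalar, Matrix.trace_fin_two, Complex.add_re]
      linarith
  have := norm_nonneg (blochVec A)
  cases s <;> simp [eigVal, sgn] <;> linarith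

theorem trace_mul_eq_bloch {A B : Matrix (Fin 2) (Fin 2) ℂ} (hA : A.IsHermitian)
    (hB : B.IsHermitian) : (A * B).trace =
      ((2 * (blochScalar A * blochScalar B + inner ℝ (blochVec A) (blochVec B)) : ℝ) : ℂ) := by
  have a01 := hA.apply 0 1
  have a00 := congrArg Complex.im (hA.apply 0 0)
  have a11 := congrArg Complex.im (hA.apply 1 1)
  have are := congrArg Complex.re a01
  have aim := congrArg Complex.im a01
  have b01 := hB.apply 0 1
  have b00 := congrArg Complex.im (hB.apply 0 0)
  have b11 := congrArg Complex.im (hB.apply 1 1)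
  have bre := congrArg Complex.re b01
  have bim := congrArg Complex.im b01
  simp only [RCLike.star_def, Complex.conj_re, Complex.conj_im] at a00 a11 are aim b00 b11 bre bim
  have a0 : (A 0 0).im = 0 := by linarith
  have a1 : (A 1 1).im = 0 := by linarith
  have b0 : (B 0 0).im = 0 := by linarith
  have b1 : (B 1 1).im = 0 := by linarith
  apply Complex.ext
  · rw [PiLp.inner_apply, Fin.sum_univ_three, Complex.ofReal_re]
    simp [blochVec, pauli, Matrix.trace_fin_two, Matrix.mul_apply, blochScalar, a0, a1, b0, b1]
    rw [are, bre, ← aim, ← bim]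
    ring
  · rw [Complex.ofReal_im]
    simp [Matrix.trace_fin_two, Matrix.mul_apply, a0, a1, b0, b1]
    rw [are, bre, ← aim, ← bim]
    ring

theorem DensityMatrix.sum_eigVal (ρ : DensityMatrix 2) : ∑ s : Bool, eigVal ρ.1 s = 1 := by
  rw [PrepareMeasure.sum_eigVal, ρ.2.2, Complex.one_re]

theorem DensityMatrix.eigVal_nonneg (ρ : DensityMatrix 2) (s : Bool) : 0 ≤ eigVal ρ.1 s :=
  PrepareMeasure.eigVal_nonneg ρ.2.1 s

/-! ### Spectral pieces of a POVM and Bob's response to a fixed vector. -/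

theorem pieceWeight_nonneg {n : ℕ} (M : POVM 2 n) (k : Fin n × Bool) : 0 ≤ pieceWeight M k :=
  div_nonneg (eigVal_nonneg (M.2.1 k.1) k.2) zero_le_two

theorem norm_pieceDir {n : ℕ} (M : POVM 2 n) (k : Fin n × Bool) : ‖pieceDir M k‖ = 1 :=
  norm_eigDir _ _

theorem sum_pieceWeight_eq {n : ℕ} (M : POVM 2 n) (b : Fin n) :
    ∑ s : Bool, pieceWeight M (b, s) = blochScalar (M.1 b) := by
  simp only [pieceWeight, ← Finset.sum_div, sum_eigVal, blochScalar]

theorem sum_pieceWeight_smul_pieceDir {n : ℕ} (M : POVM 2 n) (b : Fin n) :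
    ∑ s : Bool, pieceWeight M (b, s) • pieceDir M (b, s) = blochVec (M.1 b) := by
  have h := congrArg (fun v => (1 / 2 : ℝ) • v) (sum_eigVal_smul_eigDir (M.1 b))
  simp only [Finset.smul_sum, smul_smul] at h
  norm_num at h
  rw [Fintype.sum_bool, ← h]
  simp only [pieceWeight, pieceDir]
  congr 2 <;> ring

theorem sum_pieceWeight {n : ℕ} (M : POVM 2 n) : ∑ k, pieceWeight M k = 1 := by
  rw [Fintype.sum_prod_type]
  simp only [sum_pieceWeight_eq, blochScalar]
  rw [← Finset.sum_div, ← Complex.re_sum, ← Matrix.trace_sum, M.2.2, Matrix.trace_one]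
  simp

theorem sum_pieceWeight_smul {n : ℕ} (M : POVM 2 n) :
    ∑ k, pieceWeight M k • pieceDir M k = 0 := by
  rw [Fintype.sum_prod_type]
  simp only [sum_pieceWeight_smul_pieceDir]
  ext i
  simp only [WithLp.ofLp_sum, Finset.sum_apply, blochVec]
  rw [← Finset.sum_div, ← Complex.re_sum, ← Matrix.trace_sum, ← Finset.mul_sum, M.2.2]
  fin_cases i <;> simp [pauli, Matrix.trace_fin_two]

/-- Write `max 0 t = (|t| + t) / 2`; the linear terms cancel because `∑ p_k y_k = 0`. -/
theorem sum_pieceWeight_mul_max {n : ℕ} (M : POVM 2 n) (m : Vec3) :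
    ∑ k, pieceWeight M k * max 0 (inner ℝ (pieceDir M k) m) =
      (∑ k, pieceWeight M k * |inner ℝ (pieceDir M k) m|) / 2 := by
  have h : ∑ k, pieceWeight M k * inner ℝ (pieceDir M k) m = 0 := by
    simp only [← real_inner_smul_left, ← sum_inner, sum_pieceWeight_smul, inner_zero_left]
  have h' : ∀ k, pieceWeight M k * max 0 (inner ℝ (pieceDir M k) m) =
      (pieceWeight M k * |inner ℝ (pieceDir M k) m| +
        pieceWeight M k * inner ℝ (pieceDir M k) m) / 2 := by
    intro k
    rcases le_total 0 (inner ℝ (pieceDir M k) m) with h | h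
    · rw [max_eq_right h, abs_of_nonneg h]
      ring
    · rw [max_eq_left h, abs_of_nonpos h]
      ring
  rw [Finset.sum_congr rfl fun k _ => h' k, ← Finset.sum_div, Finset.sum_add_distrib, h, add_zero]

theorem pieceProb_nonneg {n : ℕ} (M : POVM 2 n) (m : Vec3) (k : Fin n × Bool) :
    0 ≤ pieceProb M m k := by
  have h : ∀ j, 0 ≤ pieceWeight M j * max 0 (inner ℝ (pieceDir M j) m) := fun j =>
    mul_nonneg (pieceWeight_nonneg M j) (le_max_left _ _)
  rw [pieceProb]
  split_ifs
  · exact pieceWeight_nonneg M k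
  · exact div_nonneg (h k) (Finset.sum_nonneg fun j _ => h j)

theorem sum_pieceProb {n : ℕ} (M : POVM 2 n) (m : Vec3) : ∑ k, pieceProb M m k = 1 := by
  simp only [pieceProb]
  split_ifs with h
  · exact sum_pieceWeight M
  · rw [← Finset.sum_div, div_self h]

theorem pieceProb_le_one {n : ℕ} (M : POVM 2 n) (m : Vec3) (k : Fin n × Bool) :
    pieceProb M m k ≤ 1 := by
  rw [← sum_pieceProb M m]
  exact Finset.single_le_sum (fun j _ => pieceProb_nonneg M m j) (Finset.mem_univ k)

theorem abs_pieceProb_le_one {n : ℕ} (M : POVM 2 n) (m : Vec3) (k : Fin n × Bool) :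
    |pieceProb M m k| ≤ 1 := by
  rw [abs_of_nonneg (pieceProb_nonneg M m k)]
  exact pieceProb_le_one M m k

/-- The density produced by Bob's first draw cancels the normalisation of his second. If the
denominator vanishes both sides are zero, so the convention chosen there does not affect the
statistics. -/
theorem sum_mul_pieceProb {n : ℕ} (M : POVM 2 n) (m : Vec3) (k : Fin n × Bool) :
    (∑ j, pieceWeight M j * |inner ℝ (pieceDir M j) m|) * pieceProb M m k =
      2 * (pieceWeight M k * max 0 (inner ℝ (pieceDir M k) m)) := by
  have h := sum_pieceWeight_mul_max M m
  rw [pieceProb]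
  split_ifs with h0
  · have hk := (Finset.sum_eq_zero_iff_of_nonneg fun j _ =>
      mul_nonneg (pieceWeight_nonneg M j) (le_max_left _ _)).1 h0 k (Finset.mem_univ k)
    rw [hk, show ∑ j, pieceWeight M j * |inner ℝ (pieceDir M j) m| = 0 by linarith]
    ring
  · rw [show ∑ j, pieceWeight M j * |inner ℝ (pieceDir M j) m| =
      2 * ∑ k, pieceWeight M k * max 0 (inner ℝ (pieceDir M k) m) by linarith]
    field_simp

theorem measurable_pieceProb {n : ℕ} (M : POVM 2 n) (k : Fin n × Bool) :
    Measurable fun m => pieceProb M m k := by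
  have h : ∀ j, Measurable fun m => pieceWeight M j * max 0 (inner ℝ (pieceDir M j) m) := fun j =>
    ((measurable_const.max (measurable_const.inner measurable_id)).const_mul _)
  have hs := Finset.measurable_sum Finset.univ fun j (_ : j ∈ Finset.univ) => h j
  exact Measurable.ite (hs (measurableSet_singleton 0)) measurable_const ((h k).div hs)

/-! ### The code -/

theorem codeword_not_isPrefix (l : Sphere2 × Sphere2) (m m' : Bool × Bool) (h : m ≠ m') :
    ¬ codeword l m <+: codeword l m' := by
  unfold codeword
  obtain ⟨i, j⟩ := m
  obtain ⟨i', j'⟩ := m'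
  split_ifs <;> cases i <;> cases j <;> cases i' <;> cases j' <;> first
    | exact absurd rfl h
    | simp [codeAPlus, codeBPlus, codeC, codeBMinus, codeAMinus]

theorem codeword_injective (l : Sphere2 × Sphere2) : Function.Injective (codeword l) := by
  intro m m' h
  by_contra hne
  exact codeword_not_isPrefix l m m' hne (h ▸ List.prefix_refl _)

theorem decodeWord_codeword (l : Sphere2 × Sphere2) (m : Bool × Bool) :
    decodeWord l (codeword l m) = m := by
  obtain ⟨i, j⟩ := m
  simp only [decodeWord, (codeword_injective l).eq_iff]
  cases i <;> cases j <;> simp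

/-- These bounds amount to `2 ^ 84 < 3 ^ 53` and `3 ^ 41 < 2 ^ 65`. They order the thresholds of the
code and are sharp enough for the numerical estimate of the cost. -/
theorem logb_two_three_mem : Real.logb 2 3 ∈ Set.Ioo (84 / 53 : ℝ) (65 / 41) := by
  constructor
  · rw [Real.lt_logb_iff_rpow_lt one_lt_two (by norm_num),
      ← Real.rpow_lt_rpow_iff (z := 53) (by positivity) (by norm_num) (by norm_num),
      ← Real.rpow_mul (by norm_num)]
    norm_num
  · rw [Real.logb_lt_iff_lt_rpow one_lt_two (by norm_num),
      ← Real.rpow_lt_rpow_iff (z := 41) (by norm_num) (by positivity) (by norm_num),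
      ← Real.rpow_mul (by norm_num)]
    norm_num

theorem wordLength_codeword_le (l : Sphere2 × Sphere2) (m : Bool × Bool) :
    wordLength (codeword l m) ≤ 3 := by
  have h := logb_two_three_mem.2
  unfold codeword
  obtain ⟨i, j⟩ := m
  split_ifs <;> cases i <;> cases j <;>
    simp [codeAPlus, codeBPlus, codeC, codeBMinus, codeAMinus, wordLength, digitLength] <;> linarith

theorem wordLength_codeword_nonneg (l : Sphere2 × Sphere2) (m : Bool × Bool) :
    0 ≤ wordLength (codeword l m) := by
  have h := logb_two_three_mem.1
  refine List.sum_nonneg fun x hx => ?_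
  obtain ⟨d, -, rfl⟩ := List.mem_map.1 hx
  cases d <;> simp [digitLength]
  linarith

/-! ### Measurability -/

theorem measurable_angleParam : Measurable angleParam := by
  refine measurable_const.pow (Measurable.div_const ?_ _)
  unfold InnerProductGeometry.angle
  fun_prop

theorem measurableSet_codeword_eq (m : Bool × Bool) (c : Word) :
    MeasurableSet {l | c = codeword l m} := by
  -- With the discrete σ-algebra on words, the level set is the preimage of a singleton.
  let _ : MeasurableSpace Word := ⊤
  have h : Measurable fun l => codeword l m := by
    unfold codeword
    have e : ∀ l, (if angleParam l ≤ 9 / 8 then codeAPlus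
        else if angleParam l ≤ 4 / 3 then codeBPlus
        else if angleParam l < 3 / 2 then codeC
        else if angleParam l < 16 / 9 then codeBMinus
        else codeAMinus) m = if angleParam l ≤ 9 / 8 then codeAPlus m
        else if angleParam l ≤ 4 / 3 then codeBPlus m
        else if angleParam l < 3 / 2 then codeC m
        else if angleParam l < 16 / 9 then codeBMinus m
        else codeAMinus m := by
      intro l
      split_ifs <;> rfl
    simp only [e]
    have ha := measurable_angleParam
    exact .ite (measurableSet_le ha measurable_const) measurable_const <|
      .ite (measurableSet_le ha measurable_const) measurable_const <|
      .ite (measurableSet_lt ha measurable_const) measurable_const <|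
      .ite (measurableSet_lt ha measurable_const) measurable_const measurable_const
  have h' := h (MeasurableSpace.measurableSet_top (s := {c}))
  convert h' using 1
  ext l
  exact eq_comm

theorem measurable_stepBit : Measurable stepBit := by
  have : stepBit = fun z => if 0 ≤ z then true else false := by
    ext z
    simp [stepBit]
  rw [this]
  exact .ite measurableSet_Ici measurable_const measurable_const

theorem measurable_regionIndex (x : Vec3) : Measurable fun l => regionIndex l x :=
  (measurable_stepBit.comp ((measurable_inner_coe x).comp measurable_fst)).prodMk
    (measurable_stepBit.comp ((measurable_inner_coe x).comp measurable_snd))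

theorem measurable_decodeWord (w : Word) : Measurable fun l => decodeWord l w :=
  .ite (measurableSet_codeword_eq _ w) measurable_const <|
    .ite (measurableSet_codeword_eq _ w) measurable_const <|
    .ite (measurableSet_codeword_eq _ w) measurable_const measurable_const

theorem measurable_aliceProb (ρ : DensityMatrix 2) (c : Word) :
    Measurable fun l => aliceProb ρ l c := by
  refine Finset.measurable_sum _ fun s _ => Measurable.const_mul (.ite ?_ measurable_const
    measurable_const) _
  have : {l | c = codeword l (regionIndex l (eigDir ρ.1 s))} =
      ⋃ m, {l | regionIndex l (eigDir ρ.1 s) = m} ∩ {l | c = codeword l m} := by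
    ext l
    simp
  rw [this]
  exact .iUnion fun m => (measurable_regionIndex _ (measurableSet_singleton m)).inter
    (measurableSet_codeword_eq m c)

theorem measurable_flipVec {β : Type*} [MeasurableSpace β] {f : β → Bool} {g : β → Sphere2}
    (hf : Measurable f) (hg : Measurable g) : Measurable fun b => flipVec (f b) (g b) := by
  have h : Measurable fun p : Sphere2 × Bool => flipVec p.2 p.1 :=
    measurable_from_prod_countable_left fun c => measurable_subtype_coe.const_smul (sgn c)
  exact h.comp (hg.prodMk hf)

theorem measurable_chosen {f : Sphere2 × Sphere2 → Bool × Bool} (hf : Measurable f) (y : Vec3) :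
    Measurable fun l => chosen l (f l) y := by
  have h1 := measurable_flipVec (measurable_fst.comp hf) measurable_fst
  have h2 := measurable_flipVec (measurable_snd.comp hf) measurable_snd
  have h3 : Measurable fun v : Vec3 => |inner ℝ v y| :=
    measurable_norm.comp (Measurable.inner (𝕜 := ℝ) measurable_id measurable_const)
  exact Measurable.ite (measurableSet_le (h3.comp h2) (h3.comp h1)) h1 h2

theorem measurable_bobProb (y : Measurement 2) (w : Word) (b : Outcome y) :
    Measurable fun l => bobProb y l w b :=
  Finset.measurable_sum _ fun k _ => (Finset.measurable_sum _ fun s _ =>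
    (measurable_pieceProb y.2 (b, s)).comp
      (measurable_chosen (measurable_decodeWord w) (pieceDir y.2 k))).const_mul _

/-! ### Validity of the model -/

theorem aliceProb_nonneg (ρ : DensityMatrix 2) (l : Sphere2 × Sphere2) (c : Word) :
    0 ≤ aliceProb ρ l c :=
  Finset.sum_nonneg fun _ _ => mul_nonneg (ρ.eigVal_nonneg _) (by split_ifs <;> norm_num)

/-- Every sum over messages collapses to the two eigenstates; normalisation, behavior and cost are
the cases of `f` used later. -/
theorem hasSum_aliceProb_mul (ρ : DensityMatrix 2) (l : Sphere2 × Sphere2) (f : Word → ℝ) :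
    HasSum (fun c => aliceProb ρ l c * f c)
      (∑ s : Bool, eigVal ρ.1 s * f (codeword l (regionIndex l (eigDir ρ.1 s)))) := by
  simp only [aliceProb, Finset.sum_mul]
  refine hasSum_sum fun s _ => ?_
  have h := hasSum_ite_eq (codeword l (regionIndex l (eigDir ρ.1 s)))
    (eigVal ρ.1 s * f (codeword l (regionIndex l (eigDir ρ.1 s))))
  convert h using 2 with c
  split_ifs with hc
  · rw [mul_one, hc]
  · simp

theorem bobProb_nonneg (y : Measurement 2) (l : Sphere2 × Sphere2) (w : Word) (b : Outcome y) :
    0 ≤ bobProb y l w b :=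
  Finset.sum_nonneg fun k _ => mul_nonneg (pieceWeight_nonneg _ k)
    (Finset.sum_nonneg fun _ _ => pieceProb_nonneg _ _ _)

theorem sum_bobProb (y : Measurement 2) (l : Sphere2 × Sphere2) (w : Word) :
    ∑ b, bobProb y l w b = 1 := by
  simp only [bobProb]
  rw [Finset.sum_comm]
  simp only [← Finset.mul_sum, ← Fintype.sum_prod_type, sum_pieceProb, mul_one]
  exact sum_pieceWeight y.2

theorem qubitProtocol_isValid : qubitProtocol.IsValid := by
  refine ⟨inferInstanceAs (IsProbabilityMeasure (uniformSphere.prod uniformSphere)),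
    aliceProb_nonneg, fun ρ l => ?_, measurable_aliceProb, bobProb_nonneg, fun y l w => ?_,
    measurable_bobProb⟩
  · have h := hasSum_aliceProb_mul ρ l fun _ => 1
    simp only [mul_one, ρ.sum_eigVal] at h
    exact h
  · have h := hasSum_fintype fun b => bobProb y l w b
    rwa [sum_bobProb] at h

/-! ### Simulation of the qubit -/

/-- The vector `± l` in the closed hemisphere around `x`. -/
noncomputable def flipToward (x : Vec3) (l : Sphere2) : Vec3 :=
  flipVec (stepBit (inner ℝ x (l : Vec3))) l

theorem measurable_flipToward (x : Vec3) : Measurable (flipToward x) :=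
  measurable_flipVec (measurable_stepBit.comp (measurable_inner_coe x)) measurable_id

theorem abs_inner_flipVec (c : Bool) (l : Sphere2) (y : Vec3) :
    |inner ℝ (flipVec c l) y| = |inner ℝ y (l : Vec3)| := by
  rw [flipVec, real_inner_smul_left, abs_mul, real_inner_comm]
  cases c <;> simp [sgn]

theorem abs_inner_flipToward (x y : Vec3) (l : Sphere2) :
    |inner ℝ y (flipToward x l)| = |inner ℝ y (l : Vec3)| :=
  (congrArg abs (real_inner_comm _ _)).trans (abs_inner_flipVec _ _ _)

theorem inner_flipToward_self (x : Vec3) (l : Sphere2) :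
    inner ℝ x (flipToward x l) = |inner ℝ x (l : Vec3)| := by
  rw [flipToward, flipVec, real_inner_smul_right, stepBit]
  by_cases h : 0 ≤ inner ℝ x (l : Vec3)
  · simp [h, sgn, abs_of_nonneg]
  · simp [h, sgn, abs_of_neg (not_le.1 h)]

theorem norm_flipToward (x : Vec3) (l : Sphere2) : ‖flipToward x l‖ = 1 := by
  rw [flipToward, flipVec, norm_smul, norm_eq_of_mem_sphere]
  cases stepBit _ <;> simp [sgn]

theorem abs_inner_coe_mem {x : Vec3} (hx : ‖x‖ = 1) (l : Sphere2) :
    |inner ℝ x (l : Vec3)| ∈ Set.Icc (0 : ℝ) 1 := by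
  refine ⟨abs_nonneg _, (abs_real_inner_le_norm _ _).trans ?_⟩
  rw [hx, norm_eq_of_mem_sphere, one_mul]

/-- Flips do not change absolute overlaps, so the choice depends on the unflipped vectors only.
Given one of them, it is chosen with probability `|y · l|`, by the uniform law of the other overlap;
the two vectors contribute equally. -/
theorem integral_chosen {x y : Vec3} (hy : ‖y‖ = 1) {g : Vec3 → ℝ} (hg : Measurable g)
    {C : ℝ} (hC : ∀ v, |g v| ≤ C) :
    ∫ l, g (chosen l (regionIndex l x) y) ∂(uniformSphere.prod uniformSphere) =
      2 * ∫ l, |inner ℝ y (l : Vec3)| * g (flipToward x l) ∂uniformSphere := by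
  set S : Set (Sphere2 × Sphere2) :=
    {l | |inner ℝ y (l.2 : Vec3)| ≤ |inner ℝ y (l.1 : Vec3)|} with hS
  have hSm : MeasurableSet S := measurableSet_le
    ((measurable_inner_coe y).comp measurable_snd).norm
    ((measurable_inner_coe y).comp measurable_fst).norm
  have hgF := hg.comp (measurable_flipToward x)
  have hi1 : Integrable (S.indicator fun l => g (flipToward x l.1))
      (uniformSphere.prod uniformSphere) :=
    (Integrable.of_bound (hgF.comp measurable_fst).aestronglyMeasurable C
      (.of_forall fun l => hC _)).indicator hSm
  have hi2 : Integrable (Sᶜ.indicator fun l => g (flipToward x l.2))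
      (uniformSphere.prod uniformSphere) :=
    (Integrable.of_bound (hgF.comp measurable_snd).aestronglyMeasurable C
      (.of_forall fun l => hC _)).indicator hSm.compl
  have hsplit : ∀ l, g (chosen l (regionIndex l x) y) =
      S.indicator (fun l => g (flipToward x l.1)) l +
        Sᶜ.indicator (fun l => g (flipToward x l.2)) l := by
    intro l
    by_cases h : l ∈ S
    · rw [Set.indicator_of_mem h, Set.indicator_of_notMem (by simpa using h), add_zero, chosen,
        if_pos]
      · rfl
      · rw [abs_inner_flipVec, abs_inner_flipVec]
        exact h
    · rw [Set.indicator_of_notMem h, Set.indicator_of_mem (by simpa using h), zero_add, chosen,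
        if_neg]
      · rfl
      · rw [abs_inner_flipVec, abs_inner_flipVec]
        exact h
  rw [integral_congr_ae (.of_forall hsplit), integral_add hi1 hi2, integral_prod _ hi1,
    integral_prod_symm _ hi2, two_mul]
  congr 1
  · refine integral_congr_ae (.of_forall fun l => ?_)
    have hm : MeasurableSet {l' : Sphere2 | |inner ℝ y (l' : Vec3)| ≤ |inner ℝ y (l : Vec3)|} :=
      measurableSet_le (measurable_inner_coe y).norm measurable_const
    have e : (fun l' => S.indicator (fun l => g (flipToward x l.1)) (l, l')) =
        {l' : Sphere2 | |inner ℝ y (l' : Vec3)| ≤ |inner ℝ y (l : Vec3)|}.indicator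
          fun _ => g (flipToward x l) := rfl
    beta_reduce
    rw [e, integral_indicator_const _ hm,
      uniformSphere_real_abs_inner_le hy (abs_inner_coe_mem hy l), smul_eq_mul]
  · refine integral_congr_ae (.of_forall fun l => ?_)
    have hm : MeasurableSet {l' : Sphere2 | |inner ℝ y (l' : Vec3)| < |inner ℝ y (l : Vec3)|} :=
      measurableSet_lt (measurable_inner_coe y).norm measurable_const
    have e : (fun l' => Sᶜ.indicator (fun l => g (flipToward x l.2)) (l', l)) =
        {l' : Sphere2 | |inner ℝ y (l' : Vec3)| < |inner ℝ y (l : Vec3)|}.indicator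
          fun _ => g (flipToward x l) := by
      ext l'
      by_cases h : |inner ℝ y (l' : Vec3)| < |inner ℝ y (l : Vec3)|
      · rw [Set.indicator_of_mem (show (l', l) ∈ Sᶜ from not_le.2 h)]
        simp [Set.indicator, h]
      · rw [Set.indicator_of_notMem (show (l', l) ∉ Sᶜ from fun h' => h (not_le.1 h'))]
        simp [Set.indicator, h]
    beta_reduce
    rw [e, integral_indicator_const _ hm,
      uniformSphere_real_abs_inner_lt hy (abs_inner_coe_mem hy l), smul_eq_mul]

/-- The half-turn `R` about the axis `x` preserves the measure and commutes with the flip. Averaging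
a flipped vector with its image leaves `|x · l| x`, and `|x · l|` has mean `1/2`. -/
theorem integral_inner_flipToward {x : Vec3} (hx : ‖x‖ = 1) (y : Vec3) :
    ∫ l, inner ℝ y (flipToward x l) ∂uniformSphere = inner ℝ x y / 2 := by
  set R : Vec3 ≃ₗᵢ[ℝ] Vec3 := (ℝ ∙ x).reflection with hR
  have hint : ∀ z, Integrable (fun l => inner ℝ z (flipToward x l)) uniformSphere := fun z =>
    .of_bound (measurable_const.inner (measurable_flipToward x)).aestronglyMeasurable ‖z‖
      (.of_forall fun l => (norm_inner_le_norm _ _).trans (by rw [norm_flipToward, mul_one]))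
  have hRv : ∀ v, R v = (2 * inner ℝ x v) • x - v := by
    intro v
    rw [hR, Submodule.reflection_apply, Submodule.starProjection_unit_singleton ℝ hx, two_smul, mul_smul,
      two_smul ℝ]
  have hflip : ∀ l, inner ℝ y (flipToward x (sphereMap R l)) =
      2 * inner ℝ x y * |inner ℝ x (l : Vec3)| - inner ℝ y (flipToward x l) := by
    intro l
    have h1 : inner ℝ x (R l) = inner ℝ x (l : Vec3) := by
      rw [hRv, inner_sub_right, real_inner_smul_right, real_inner_self_eq_norm_sq, hx]
      ring
    have h2 : flipToward x (sphereMap R l) = R (flipToward x l) := by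
      simp only [flipToward, flipVec, coe_sphereMap, h1, map_smul]
    rw [h2, hRv, inner_sub_right, real_inner_smul_right, inner_flipToward_self,
      real_inner_comm x y]
    ring
  have h := (measurePreserving_sphereMap R).integral_comp' (f := ⟨⟨sphereMap R, sphereMap R.symm,
    fun v => by ext1; simp, fun v => by ext1; simp⟩, measurable_sphereMap R,
    measurable_sphereMap R.symm⟩) fun l => inner ℝ y (flipToward x l)
  have h' : ∫ l, inner ℝ y (flipToward x (sphereMap R l)) ∂uniformSphere =
    ∫ l, inner ℝ y (flipToward x l) ∂uniformSphere := h
  simp only [hflip] at h'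
  have habs : Integrable (fun l : Sphere2 => |inner ℝ x (l : Vec3)|) uniformSphere := by
    simpa only [inner_flipToward_self] using hint x
  rw [integral_sub (habs.const_mul _) (hint y), integral_const_mul, integral_abs_inner hx] at h'
  linarith

theorem integral_max_inner_flipToward {x y : Vec3} (hx : ‖x‖ = 1) (hy : ‖y‖ = 1) :
    ∫ l, max 0 (inner ℝ y (flipToward x l)) ∂uniformSphere = (1 + inner ℝ x y) / 4 := by
  have h : ∀ l, max 0 (inner ℝ y (flipToward x l)) =
      (|inner ℝ y (l : Vec3)| + inner ℝ y (flipToward x l)) / 2 := by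
    intro l
    rw [← abs_inner_flipToward x]
    rcases le_total 0 (inner ℝ y (flipToward x l)) with h | h
    · rw [max_eq_right h, abs_of_nonneg h]
      ring
    · rw [max_eq_left h, abs_of_nonpos h]
      ring
  have h1 : Integrable (fun l : Sphere2 => |inner ℝ y (l : Vec3)|) uniformSphere :=
    .of_bound (measurable_inner_coe y).norm.aestronglyMeasurable 1 (.of_forall fun l => by
      simpa using (abs_inner_coe_mem hy l).2)
  have h2 : Integrable (fun l => inner ℝ y (flipToward x l)) uniformSphere :=
    .of_bound (measurable_const.inner (measurable_flipToward x)).aestronglyMeasurable ‖y‖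
      (.of_forall fun l => (norm_inner_le_norm _ _).trans (by rw [norm_flipToward, mul_one]))
  simp only [h]
  rw [integral_div, integral_add h1 h2, integral_abs_inner hy, integral_inner_flipToward hx]
  ring

theorem integral_bobProb_codeword {x : Vec3} (hx : ‖x‖ = 1) (y : Measurement 2) (b : Outcome y) :
    ∫ l, bobProb y l (codeword l (regionIndex l x)) b ∂(uniformSphere.prod uniformSphere) =
      blochScalar (y.2.1 b) + inner ℝ x (blochVec (y.2.1 b)) := by
  have hmeas : ∀ k s, Measurable fun l =>
      pieceProb y.2 (chosen l (regionIndex l x) (pieceDir y.2 k)) (b, s) := fun k s =>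
    (measurable_pieceProb y.2 (b, s)).comp (measurable_chosen (measurable_regionIndex x) _)
  have hint : ∀ k s, Integrable (fun l =>
      pieceProb y.2 (chosen l (regionIndex l x) (pieceDir y.2 k)) (b, s))
      (uniformSphere.prod uniformSphere) := fun k s =>
    .of_bound (hmeas k s).aestronglyMeasurable 1 (.of_forall fun l => abs_pieceProb_le_one _ _ _)
  have hint' : ∀ k s, Integrable (fun l : Sphere2 =>
      |inner ℝ (pieceDir y.2 k) (l : Vec3)| * pieceProb y.2 (flipToward x l) (b, s))
      uniformSphere := fun k s =>
    .of_bound ((measurable_inner_coe _).norm.mul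
      ((measurable_pieceProb y.2 (b, s)).comp (measurable_flipToward x))).aestronglyMeasurable 1
      (.of_forall fun l => by
        rw [norm_mul, Real.norm_eq_abs, Real.norm_eq_abs, abs_abs]
        exact mul_le_one₀ (abs_inner_coe_mem (norm_pieceDir _ _) l).2 (abs_nonneg _)
          (abs_pieceProb_le_one _ _ _))
  have hs : ∀ s, ∑ k, pieceWeight y.2 k * ∫ l,
      pieceProb y.2 (chosen l (regionIndex l x) (pieceDir y.2 k)) (b, s)
        ∂(uniformSphere.prod uniformSphere) =
      pieceWeight y.2 (b, s) * (1 + inner ℝ x (pieceDir y.2 (b, s))) := by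
    intro s
    calc _ = ∑ k, 2 * (pieceWeight y.2 k * ∫ l : Sphere2, |inner ℝ (pieceDir y.2 k) (l : Vec3)| *
          pieceProb y.2 (flipToward x l) (b, s) ∂uniformSphere) := by
          refine Finset.sum_congr rfl fun k _ => ?_
          rw [integral_chosen (norm_pieceDir _ _) (measurable_pieceProb y.2 (b, s))
            fun v => abs_pieceProb_le_one y.2 v _]
          ring
      -- The response to the chosen vector does not depend on `k` any more, so the sum over `k`
      -- moves inside and forms the factor required by `sum_mul_pieceProb`.
      _ = 2 * ∫ l : Sphere2, (∑ k, pieceWeight y.2 k *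
            |inner ℝ (pieceDir y.2 k) (flipToward x l)|) *
          pieceProb y.2 (flipToward x l) (b, s) ∂uniformSphere := by
          rw [← Finset.mul_sum]
          simp only [← integral_const_mul (pieceWeight _ _)]
          rw [← integral_finsetSum _ fun k _ => (hint' k s).const_mul _]
          refine congrArg ((2 : ℝ) * ·) (integral_congr_ae (.of_forall fun l => ?_))
          beta_reduce
          rw [Finset.sum_mul]
          refine Finset.sum_congr rfl fun k _ => ?_
          rw [abs_inner_flipToward, mul_assoc]
      _ = _ := by
          simp only [sum_mul_pieceProb, integral_const_mul]
          rw [integral_max_inner_flipToward hx (norm_pieceDir _ _)]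
          ring
  simp only [bobProb, decodeWord_codeword]
  rw [integral_finsetSum _ fun k _ =>
    (integrable_finsetSum _ fun s _ => hint k s).const_mul _]
  simp only [integral_const_mul]
  simp only [integral_finsetSum _ fun s (_ : s ∈ Finset.univ) => hint _ s, Finset.mul_sum]
  rw [Finset.sum_comm, Finset.sum_congr rfl fun s _ => hs s, ← sum_pieceWeight_eq,
    ← sum_pieceWeight_smul_pieceDir, inner_sum, ← Finset.sum_add_distrib]
  refine Finset.sum_congr rfl fun s _ => ?_
  rw [real_inner_smul_right]
  ring

theorem simulates_qubitProtocol : Simulates 2 qubitProtocol := by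
  intro ρ y b
  have hb : ∀ s, Integrable (fun l => eigVal ρ.1 s *
      bobProb y l (codeword l (regionIndex l (eigDir ρ.1 s))) b)
      (uniformSphere.prod uniformSphere) := by
    intro s
    refine Integrable.const_mul ?_ _
    simp only [bobProb, decodeWord_codeword]
    refine integrable_finsetSum _ fun k _ => (integrable_finsetSum _ fun t _ => ?_).const_mul _
    exact .of_bound ((measurable_pieceProb y.2 (b, t)).comp
      (measurable_chosen (measurable_regionIndex _) _)).aestronglyMeasurable 1
      (.of_forall fun l => abs_pieceProb_le_one _ _ _)
  have h : qubitProtocol.behavior ρ y b = ∫ l, ∑ s : Bool, eigVal ρ.1 s *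
      bobProb y l (codeword l (regionIndex l (eigDir ρ.1 s))) b
        ∂(uniformSphere.prod uniformSphere) :=
    integral_congr_ae (.of_forall fun l =>
      (hasSum_aliceProb_mul ρ l fun c => bobProb y l c b).tsum_eq)
  rw [h, integral_finsetSum _ fun s _ => hb s]
  simp only [integral_const_mul, integral_bobProb_codeword (norm_eigDir _ _) y b]
  rw [bornProb, trace_mul_eq_bloch ρ.2.1.isHermitian (y.2.2.1 b).isHermitian]
  congr 1
  simp only [mul_add, Finset.sum_add_distrib, ← Finset.sum_mul, ← real_inner_smul_left, ← sum_inner]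
  rw [sum_eigVal_smul_eigDir, sum_eigVal, real_inner_smul_left]
  simp only [blochScalar]
  ring

/-! ### Average communication cost -/

theorem uniformSphere_real_hemisphere (a : Sphere2) :
    uniformSphere.real {v : Sphere2 | 0 ≤ inner ℝ (v : Vec3) (a : Vec3)} = 1 / 2 := by
  have h := uniformSphere_real_lune a a
  have ha : (a : Vec3) ≠ 0 := fun h0 => by
    have := norm_eq_of_mem_sphere a
    rw [h0, norm_zero] at this
    exact zero_ne_one this
  simp only [and_self, InnerProductGeometry.angle_self ha, sub_zero] at h
  rw [h]
  field_simp

theorem measurableSet_hemisphere (a : Sphere2) :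
    MeasurableSet {v : Sphere2 | 0 ≤ inner ℝ (v : Vec3) (a : Vec3)} :=
  measurableSet_le measurable_const
    (Measurable.inner (𝕜 := ℝ) measurable_subtype_coe measurable_const)

/-- The mean over the sphere of a function of the region, in terms of the angle `θ` between the
two vectors: equal bits have probability `(π - θ) / π`, different ones `θ / π`. -/
theorem integral_comp_regionIndex (l : Sphere2 × Sphere2) (f : Bool × Bool → ℝ) :
    ∫ v : Sphere2, f (regionIndex l v) ∂uniformSphere =
      (1 - InnerProductGeometry.angle (l.1 : Vec3) (l.2 : Vec3) / Real.pi) / 2 *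
        (f (false, false) + f (true, true)) +
      InnerProductGeometry.angle (l.1 : Vec3) (l.2 : Vec3) / Real.pi / 2 *
        (f (false, true) + f (true, false)) := by
  set A := {v : Sphere2 | 0 ≤ inner ℝ (v : Vec3) (l.1 : Vec3)} with hA
  set B := {v : Sphere2 | 0 ≤ inner ℝ (v : Vec3) (l.2 : Vec3)} with hB
  have hAm : MeasurableSet A := measurableSet_hemisphere l.1
  have hBm : MeasurableSet B := measurableSet_hemisphere l.2
  have hABm := hAm.inter hBm
  have hA1 : uniformSphere.real A = 1 / 2 := uniformSphere_real_hemisphere l.1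
  have hB1 : uniformSphere.real B = 1 / 2 := uniformSphere_real_hemisphere l.2
  have hAB1 : uniformSphere.real (A ∩ B) =
      (Real.pi - InnerProductGeometry.angle (l.1 : Vec3) (l.2 : Vec3)) / (2 * Real.pi) :=
    uniformSphere_real_lune l.1 l.2
  have hint : ∀ {S : Set Sphere2} (c : ℝ), MeasurableSet S →
      Integrable (S.indicator fun _ => c) uniformSphere := fun c hS =>
    (integrable_const c).indicator hS
  -- Expanding `f` in the indicators of the two hemispheres and of their intersection reduces the
  -- mean to two hemispheres and one lune.
  have hf : ∀ v : Sphere2, f (regionIndex l v) = f (false, false) +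
      A.indicator (fun _ => f (true, false) - f (false, false)) v +
      B.indicator (fun _ => f (false, true) - f (false, false)) v +
      (A ∩ B).indicator (fun _ => f (true, true) - f (true, false) - f (false, true) +
        f (false, false)) v := by
    intro v
    by_cases h1 : 0 ≤ inner ℝ (v : Vec3) (l.1 : Vec3) <;>
    by_cases h2 : 0 ≤ inner ℝ (v : Vec3) (l.2 : Vec3) <;>
    simp [Set.indicator, hA, hB, regionIndex, stepBit, h1, h2] <;> ring
  simp only [hf]
  have i1 : ∀ c d, Integrable (fun v => c + A.indicator (fun _ => d) v) uniformSphere :=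
    fun c d => (integrable_const c).add (hint d hAm)
  have i2 : ∀ c d e, Integrable (fun v => c + A.indicator (fun _ => d) v +
      B.indicator (fun _ => e) v) uniformSphere := fun c d e => (i1 c d).add (hint e hBm)
  rw [integral_add (i2 _ _ _) (hint _ hABm), integral_add (i1 _ _) (hint _ hBm),
    integral_add (integrable_const _) (hint _ hAm), integral_indicator_const _ hAm,
    integral_indicator_const _ hBm, integral_indicator_const _ hABm, hA1, hB1, hAB1]
  simp only [integral_const, probReal_univ, smul_eq_mul]
  field_simp
  ring

/-- The code used at the value `β` of the angle parameter. -/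
noncomputable def codeAt (β : ℝ) : Bool × Bool → Word :=
  if β ≤ 9 / 8 then codeAPlus
  else if β ≤ 4 / 3 then codeBPlus
  else if β < 3 / 2 then codeC
  else if β < 16 / 9 then codeBMinus
  else codeAMinus

/-- Isolates the dependence on the angle, from which rotation invariance of the message length is
read off. -/
theorem codeword_eq_codeAt (l : Sphere2 × Sphere2) : codeword l = codeAt (angleParam l) := rfl

/-- The mean length of the codewords when the shared vectors form the angle `π * u`. -/
noncomputable def meanLength (u : ℝ) : ℝ :=
  (1 - u) / 2 * (wordLength (codeAt (2 ^ u) (false, false)) +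
    wordLength (codeAt (2 ^ u) (true, true))) +
  u / 2 * (wordLength (codeAt (2 ^ u) (false, true)) + wordLength (codeAt (2 ^ u) (true, false)))

theorem measurable_wordLength_codeAt (m : Bool × Bool) :
    Measurable fun β => wordLength (codeAt β m) := by
  have e : ∀ β, wordLength (codeAt β m) = if β ≤ 9 / 8 then wordLength (codeAPlus m)
        else if β ≤ 4 / 3 then wordLength (codeBPlus m)
        else if β < 3 / 2 then wordLength (codeC m)
        else if β < 16 / 9 then wordLength (codeBMinus m)
        else wordLength (codeAMinus m) := by
    intro β
    unfold codeAt
    split_ifs <;> rfl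
  simp only [e]
  exact .ite measurableSet_Iic measurable_const <| .ite measurableSet_Iic measurable_const <|
    .ite measurableSet_Iio measurable_const <| .ite measurableSet_Iio measurable_const
    measurable_const

theorem measurable_meanLength : Measurable meanLength := by
  have h : ∀ m, Measurable fun u : ℝ => wordLength (codeAt (2 ^ u) m) := fun m =>
    (measurable_wordLength_codeAt m).comp (by fun_prop)
  unfold meanLength
  exact (Measurable.mul (by fun_prop) ((h _).add (h _))).add
    (Measurable.mul (by fun_prop) ((h _).add (h _)))

/-- The length of the message for the pure state with Bloch vector `x`. -/
noncomputable def messageLength (x : Vec3) (l : Sphere2 × Sphere2) : ℝ :=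
  wordLength (codeword l (regionIndex l x))

theorem abs_messageLength_le (x : Vec3) (l : Sphere2 × Sphere2) : |messageLength x l| ≤ 3 := by
  rw [messageLength, abs_of_nonneg (wordLength_codeword_nonneg _ _)]
  exact wordLength_codeword_le _ _

theorem measurable_messageLength :
    Measurable fun p : Sphere2 × (Sphere2 × Sphere2) => messageLength p.1 p.2 := by
  have h1 : Measurable fun p : ℝ × (Bool × Bool) => wordLength (codeAt p.1 p.2) :=
    measurable_from_prod_countable_left measurable_wordLength_codeAt
  have h2 : Measurable fun p : Sphere2 × (Sphere2 × Sphere2) => regionIndex p.2 (p.1 : Vec3) :=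
    (measurable_stepBit.comp (Measurable.inner (𝕜 := ℝ)
      (measurable_subtype_coe.comp measurable_fst)
      (measurable_subtype_coe.comp (measurable_fst.comp measurable_snd)))).prodMk
    (measurable_stepBit.comp (Measurable.inner (𝕜 := ℝ)
      (measurable_subtype_coe.comp measurable_fst)
      (measurable_subtype_coe.comp (measurable_snd.comp measurable_snd))))
  have h3 : Measurable fun p : Sphere2 × (Sphere2 × Sphere2) =>
      (angleParam p.2, regionIndex p.2 (p.1 : Vec3)) :=
    (measurable_angleParam.comp measurable_snd).prodMk h2
  exact h1.comp h3

theorem integrable_messageLength (x : Sphere2) :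
    Integrable (messageLength x) (uniformSphere.prod uniformSphere) :=
  .of_bound (measurable_messageLength.comp measurable_prodMk_left).aestronglyMeasurable 3
    (.of_forall fun l => abs_messageLength_le x l)

/-- Rotating both shared vectors along with the state preserves their law, their angle and all the
inner products involved. -/
theorem integral_messageLength_congr (x y : Sphere2) :
    ∫ l, messageLength x l ∂(uniformSphere.prod uniformSphere) =
      ∫ l, messageLength y l ∂(uniformSphere.prod uniformSphere) := by
  obtain ⟨R, hR⟩ := exists_isometry_map_eq (a := (x : Vec3)) (b := y)
    (by rw [norm_eq_of_mem_sphere, norm_eq_of_mem_sphere])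
  have hp := (measurePreserving_sphereMap R).prod (measurePreserving_sphereMap R)
  have hinv : ∀ l, messageLength y (Prod.map (sphereMap R) (sphereMap R) l) =
      messageLength x l := by
    intro l
    have h1 : angleParam (Prod.map (sphereMap R) (sphereMap R) l) = angleParam l := by
      simp only [angleParam, Prod.map_fst, Prod.map_snd, coe_sphereMap,
        InnerProductGeometry.angle, R.inner_map_map, R.norm_map]
    have h2 : regionIndex (Prod.map (sphereMap R) (sphereMap R) l) y = regionIndex l x := by
      simp only [regionIndex, Prod.map_fst, Prod.map_snd, coe_sphereMap, ← hR, R.inner_map_map]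
    rw [messageLength, messageLength, codeword_eq_codeAt, h1, h2, codeword_eq_codeAt]
  have h := integral_map (μ := uniformSphere.prod uniformSphere) (f := messageLength y)
    hp.measurable.aemeasurable
    (measurable_messageLength.comp measurable_prodMk_left).aestronglyMeasurable
  rw [hp.map_eq] at h
  rw [h]
  exact integral_congr_ae (.of_forall fun l => (hinv l).symm)

/-- As the cost is the same for all `x`, it may be averaged over `x`. After exchanging integrals the
inner one is a mean over regions at a fixed angle, and the angle to a fixed first vector has density
`sin α / 2`. -/
theorem integral_messageLength_eq (x : Sphere2) :
    ∫ l, messageLength x l ∂(uniformSphere.prod uniformSphere) =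
      ∫ α in (0 : ℝ)..Real.pi, meanLength (α / Real.pi) * (Real.sin α / 2) := by
  have hF : Measurable fun t : ℝ => meanLength (Real.arccos t / Real.pi) :=
    measurable_meanLength.comp (Real.measurable_arccos.div_const _)
  have hangle : ∀ l : Sphere2 × Sphere2, InnerProductGeometry.angle (l.1 : Vec3) (l.2 : Vec3) =
      Real.arccos (inner ℝ (l.1 : Vec3) (l.2 : Vec3)) := fun l => by
    rw [InnerProductGeometry.angle, norm_eq_of_mem_sphere, norm_eq_of_mem_sphere, mul_one, div_one]
  have hmean : ∀ l, ∫ v : Sphere2, messageLength v l ∂uniformSphere =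
      meanLength (Real.arccos (inner ℝ (l.1 : Vec3) (l.2 : Vec3)) / Real.pi) := fun l => by
    rw [← hangle]
    exact integral_comp_regionIndex l fun m => wordLength (codeword l m)
  have hint : Integrable (Function.uncurry fun v : Sphere2 => messageLength v)
      (uniformSphere.prod (uniformSphere.prod uniformSphere)) :=
    .of_bound measurable_messageLength.aestronglyMeasurable 3
      (.of_forall fun p => abs_messageLength_le p.1 p.2)
  have hint' : Integrable (fun l : Sphere2 × Sphere2 =>
      meanLength (Real.arccos (inner ℝ (l.1 : Vec3) (l.2 : Vec3)) / Real.pi))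
      (uniformSphere.prod uniformSphere) := by
    have := hint.integral_prod_right
    exact this.congr (.of_forall hmean)
  calc ∫ l, messageLength x l ∂(uniformSphere.prod uniformSphere)
      = ∫ v : Sphere2, ∫ l, messageLength v l ∂(uniformSphere.prod uniformSphere)
          ∂uniformSphere := by
        simp only [fun v : Sphere2 => integral_messageLength_congr v x, integral_const,
          probReal_univ, one_smul]
    _ = ∫ l, meanLength (Real.arccos (inner ℝ (l.1 : Vec3) (l.2 : Vec3)) / Real.pi)
          ∂(uniformSphere.prod uniformSphere) := by
        rw [integral_integral_swap hint]
        exact integral_congr_ae (.of_forall hmean)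
    _ = ∫ l : Sphere2, (∫ α in (0 : ℝ)..Real.pi, meanLength (α / Real.pi) * (Real.sin α / 2))
          ∂uniformSphere := by
        rw [integral_prod _ hint']
        refine integral_congr_ae (.of_forall fun l => ?_)
        beta_reduce
        rw [integral_comp_inner (norm_eq_of_mem_sphere l) hF]
        refine intervalIntegral.integral_congr fun α hα => ?_
        rw [Set.uIcc_of_le Real.pi_pos.le] at hα
        simp only [Real.arccos_cos hα.1 hα.2]
    _ = _ := by simp

/-! ### The integral over the angle. -/

theorem integral_affine_mul_sin (A B p q : ℝ) :
    ∫ α in (Real.pi * p)..(Real.pi * q), (A + B * (α / Real.pi)) * (Real.sin α / 2) =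
      ((A + B * p) * Real.cos (Real.pi * p) - (A + B * q) * Real.cos (Real.pi * q)) / 2 +
        B / (2 * Real.pi) * (Real.sin (Real.pi * q) - Real.sin (Real.pi * p)) := by
  have hpi := Real.pi_ne_zero
  have h : ∀ α ∈ Set.uIcc (Real.pi * p) (Real.pi * q), HasDerivAt
      (fun α => -((A + B * (α / Real.pi)) * Real.cos α) / 2 + B / (2 * Real.pi) * Real.sin α)
      ((A + B * (α / Real.pi)) * (Real.sin α / 2)) α := by
    intro α _
    have h1 : HasDerivAt (fun α => A + B * (α / Real.pi)) (B * (1 / Real.pi)) α :=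
      (((hasDerivAt_id α).div_const _).const_mul B).const_add A
    refine (((h1.mul (Real.hasDerivAt_cos α)).neg.div_const 2).add
      ((Real.hasDerivAt_sin α).const_mul (B / (2 * Real.pi)))).congr_deriv ?_
    field_simp
    ring
  rw [intervalIntegral.integral_eq_sub_of_hasDerivAt h
    (Continuous.intervalIntegrable (by fun_prop) _ _), mul_div_cancel_left₀ _ hpi,
    mul_div_cancel_left₀ _ hpi]
  ring

theorem integral_meanLength_piece {A B p q : ℝ} (hpq : p ≤ q)
    (h : ∀ u ∈ Set.Icc p q, meanLength u = A + B * u) :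
    IntervalIntegrable (fun α => meanLength (α / Real.pi) * (Real.sin α / 2)) volume
      (Real.pi * p) (Real.pi * q) ∧
    ∫ α in (Real.pi * p)..(Real.pi * q), meanLength (α / Real.pi) * (Real.sin α / 2) =
      ((A + B * p) * Real.cos (Real.pi * p) - (A + B * q) * Real.cos (Real.pi * q)) / 2 +
        B / (2 * Real.pi) * (Real.sin (Real.pi * q) - Real.sin (Real.pi * p)) := by
  have hle : Real.pi * p ≤ Real.pi * q := mul_le_mul_of_nonneg_left hpq Real.pi_pos.le
  have he : ∀ α ∈ Set.uIcc (Real.pi * p) (Real.pi * q),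
      meanLength (α / Real.pi) * (Real.sin α / 2) =
        (A + B * (α / Real.pi)) * (Real.sin α / 2) := by
    intro α hα
    rw [Set.uIcc_of_le hle] at hα
    rw [h _ ⟨by rw [le_div_iff₀ Real.pi_pos]; linarith [hα.1],
      by rw [div_le_iff₀ Real.pi_pos]; linarith [hα.2]⟩]
  refine ⟨?_, by rw [intervalIntegral.integral_congr he, integral_affine_mul_sin]⟩
  refine IntervalIntegrable.congr (fun α hα => (he α (Set.uIoc_subset_uIcc hα)).symm)
    (Continuous.intervalIntegrable (by fun_prop) _ _)

theorem rpow_two_le_iff {u b : ℝ} (hb : 0 < b) : (2 : ℝ) ^ u ≤ b ↔ u ≤ Real.logb 2 b :=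
  (Real.le_logb_iff_rpow_le one_lt_two hb).symm

theorem rpow_two_lt_iff {u b : ℝ} (hb : 0 < b) : (2 : ℝ) ^ u < b ↔ u < Real.logb 2 b :=
  (Real.lt_logb_iff_rpow_lt one_lt_two hb).symm

theorem meanLength_eq_ite (u : ℝ) : meanLength u =
    if u ≤ 2 * Real.logb 2 3 - 3 then 3 / 2 + 3 / 2 * u
    else if u ≤ 2 - Real.logb 2 3 then Real.logb 2 3 + 1 * u
    else if u < Real.logb 2 3 - 1 then 2 + 0 * u
    else if u < 4 - 2 * Real.logb 2 3 then Real.logb 2 3 + 1 + -1 * u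
    else 3 + -(3 / 2) * u := by
  have h2 : Real.logb 2 2 = 1 := Real.logb_self_eq_one one_lt_two
  have h4 : Real.logb 2 4 = 2 := by
    rw [show (4 : ℝ) = 2 ^ 2 by norm_num, Real.logb_pow, h2]
    norm_num
  have h8 : Real.logb 2 8 = 3 := by
    rw [show (8 : ℝ) = 2 ^ 3 by norm_num, Real.logb_pow, h2]
    norm_num
  have h16 : Real.logb 2 16 = 4 := by
    rw [show (16 : ℝ) = 2 ^ 4 by norm_num, Real.logb_pow, h2]
    norm_num
  have h9 : Real.logb 2 9 = 2 * Real.logb 2 3 := by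
    rw [show (9 : ℝ) = 3 ^ 2 by norm_num, Real.logb_pow]
    norm_num
  have e1 : Real.logb 2 (9 / 8) = 2 * Real.logb 2 3 - 3 := by
    rw [Real.logb_div (by norm_num) (by norm_num), h9, h8]
  have e2 : Real.logb 2 (4 / 3) = 2 - Real.logb 2 3 := by
    rw [Real.logb_div (by norm_num) (by norm_num), h4]
  have e3 : Real.logb 2 (3 / 2) = Real.logb 2 3 - 1 := by
    rw [Real.logb_div (by norm_num) (by norm_num), h2]
  have e4 : Real.logb 2 (16 / 9) = 4 - 2 * Real.logb 2 3 := by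
    rw [Real.logb_div (by norm_num) (by norm_num), h16, h9]
  simp only [meanLength, codeAt, rpow_two_le_iff (show (0 : ℝ) < 9 / 8 by norm_num),
    rpow_two_le_iff (show (0 : ℝ) < 4 / 3 by norm_num),
    rpow_two_lt_iff (show (0 : ℝ) < 3 / 2 by norm_num),
    rpow_two_lt_iff (show (0 : ℝ) < 16 / 9 by norm_num), e1, e2, e3, e4]
  split_ifs <;>
    simp [codeAPlus, codeBPlus, codeC, codeBMinus, codeAMinus, wordLength, digitLength] <;> ring

theorem integral_meanLength : ∫ α in (0 : ℝ)..Real.pi,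
    meanLength (α / Real.pi) * (Real.sin α / 2) = averageCost := by
  obtain ⟨hL1, hL2⟩ := logb_two_three_mem
  set L := Real.logb 2 3 with hL
  obtain ⟨i1, e1⟩ := integral_meanLength_piece (A := 3 / 2) (B := 3 / 2) (p := 0) (q := 2 * L - 3)
    (by linarith) fun u hu => by
      rw [meanLength_eq_ite, if_pos hu.2]
  -- An endpoint may belong to the neighbouring branch. This is harmless because adjacent codes have
  -- equal mean length at their common threshold, which is what `linarith` checks.
  obtain ⟨i2, e2⟩ := integral_meanLength_piece (A := L) (B := 1) (p := 2 * L - 3) (q := 2 - L)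
    (by linarith) fun u hu => by
      rw [meanLength_eq_ite]
      have := hu.1
      have := hu.2
      split_ifs <;> linarith
  obtain ⟨i3, e3⟩ := integral_meanLength_piece (A := 2) (B := 0) (p := 2 - L) (q := L - 1)
    (by linarith) fun u hu => by
      rw [meanLength_eq_ite]
      have := hu.1
      have := hu.2
      split_ifs <;> linarith
  obtain ⟨i4, e4⟩ := integral_meanLength_piece (A := L + 1) (B := -1) (p := L - 1)
    (q := 4 - 2 * L) (by linarith) fun u hu => by
      rw [meanLength_eq_ite]
      have := hu.1
      have := hu.2
      split_ifs <;> linarith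
  obtain ⟨i5, e5⟩ := integral_meanLength_piece (A := 3) (B := -(3 / 2)) (p := 4 - 2 * L) (q := 1)
    (by linarith) fun u hu => by
      rw [meanLength_eq_ite]
      have := hu.1
      have := hu.2
      split_ifs <;> linarith
  have h := intervalIntegral.integral_add_adjacent_intervals
    (((i1.trans i2).trans i3).trans i4) i5
  rw [← intervalIntegral.integral_add_adjacent_intervals ((i1.trans i2).trans i3) i4,
    ← intervalIntegral.integral_add_adjacent_intervals (i1.trans i2) i3,
    ← intervalIntegral.integral_add_adjacent_intervals i1 i2, e1, e2, e3, e4, e5] at h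
  simp only [mul_zero, mul_one] at h
  rw [← h]
  -- By continuity of the mean length the cosines at the inner thresholds telescope, and those at
  -- `0` and `π` give `3/2`. The sines survive, weighted by the jumps of the slope.
  have s1 : Real.sin (Real.pi * (2 * L - 3)) = -Real.sin (2 * Real.pi * L) := by
    rw [show Real.pi * (2 * L - 3) = 2 * Real.pi * L - Real.pi - (1 : ℕ) * (2 * Real.pi) by
      push_cast; ring, Real.sin_sub_nat_mul_two_pi, Real.sin_sub_pi]
  have s2 : Real.sin (Real.pi * (2 - L)) = -Real.sin (Real.pi * L) := by
    rw [show Real.pi * (2 - L) = 2 * Real.pi - Real.pi * L by ring, Real.sin_two_pi_sub]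
  have s3 : Real.sin (Real.pi * (L - 1)) = -Real.sin (Real.pi * L) := by
    rw [mul_sub, mul_one, Real.sin_sub_pi]
  have s4 : Real.sin (Real.pi * (4 - 2 * L)) = -Real.sin (2 * Real.pi * L) := by
    rw [show Real.pi * (4 - 2 * L) = (2 : ℕ) * (2 * Real.pi) - 2 * Real.pi * L by
      push_cast; ring, Real.sin_nat_mul_two_pi_sub]
  rw [s1, s2, s3, s4, Real.sin_zero, Real.sin_pi, Real.cos_zero, Real.cos_pi, averageCost, ← hL]
  field_simp
  ring

/-! ### Cost of arbitrary states and its numerical value. -/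

theorem expectedLength_qubitProtocol (ρ : DensityMatrix 2) (l : Sphere2 × Sphere2) :
    qubitProtocol.expectedLength ρ l =
      ∑ s : Bool, eigVal ρ.1 s * messageLength (eigDir ρ.1 s) l :=
  (hasSum_aliceProb_mul ρ l wordLength).tsum_eq

/-- The density matrix of the pure state with Bloch vector `(sin t, 0, cos t)`. -/
noncomputable def pureState (t : ℝ) : DensityMatrix 2 :=
  ⟨Matrix.vecMulVec ![(Real.cos (t / 2) : ℂ), (Real.sin (t / 2) : ℂ)]
    (star ![(Real.cos (t / 2) : ℂ), (Real.sin (t / 2) : ℂ)]),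
    Matrix.posSemidef_vecMulVec_self_star _, by
      have h := Real.cos_sq_add_sin_sq (t / 2)
      simp only [Matrix.trace_fin_two, Matrix.vecMulVec_apply, Pi.star_apply, Matrix.cons_val_zero,
        Matrix.cons_val_one, RCLike.star_def, Complex.conj_ofReal, ← Complex.ofReal_mul,
        ← Complex.ofReal_add]
      rw [← Complex.ofReal_one, ← h]
      congr 1
      ring⟩

theorem blochVec_pureState (t : ℝ) :
    blochVec (pureState t).1 = (1 / 2 : ℝ) • !₂[Real.sin t, 0, Real.cos t] := by
  have hc := Real.cos_two_mul (t / 2)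
  have hs := Real.sin_two_mul (t / 2)
  have h := Real.cos_sq_add_sin_sq (t / 2)
  rw [mul_div_cancel₀ t two_ne_zero] at hc hs
  ext i
  fin_cases i
  · simp only [blochVec, pauli, pureState, Matrix.trace_fin_two, Matrix.mul_apply,
      Fin.sum_univ_two, Matrix.vecMulVec_apply]
    simp [-Complex.ofReal_cos, -Complex.ofReal_sin, hs]
    ring
  · simp only [blochVec, pauli, pureState, Matrix.trace_fin_two, Matrix.mul_apply,
      Fin.sum_univ_two, Matrix.vecMulVec_apply]
    simp [-Complex.ofReal_cos, -Complex.ofReal_sin]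
  · simp only [blochVec, pauli, pureState, Matrix.trace_fin_two, Matrix.mul_apply,
      Fin.sum_univ_two, Matrix.vecMulVec_apply]
    simp [-Complex.ofReal_cos, -Complex.ofReal_sin, hc]
    linarith

theorem hasAverageCost_qubitProtocol : qubitProtocol.HasAverageCost averageCost := by
  have hi : ∀ (ρ : DensityMatrix 2) (s : Bool), Integrable (fun l =>
      eigVal ρ.1 s * messageLength (eigDir ρ.1 s) l) (uniformSphere.prod uniformSphere) :=
    fun ρ s => (integrable_messageLength ⟨eigDir ρ.1 s, by
      rw [mem_sphere_zero_iff_norm, norm_eigDir]⟩).const_mul _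
  refine ⟨fun ρ l => (hasSum_aliceProb_mul ρ l wordLength).summable, fun ρ => ?_, ?_⟩
  · exact (integrable_finsetSum Finset.univ fun s _ => hi ρ s).congr
      (.of_forall fun l => (expectedLength_qubitProtocol ρ l).symm)
  -- The mean cost does not depend on the state, so the supremum is over a single value.
  · have h : ∀ ρ, ∫ l, qubitProtocol.expectedLength ρ l ∂qubitProtocol.law = averageCost := by
      intro ρ
      have hs : ∀ s, ∫ l, messageLength (eigDir ρ.1 s) l ∂(uniformSphere.prod uniformSphere) =
          averageCost := fun s => by
        rw [← integral_meanLength]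
        exact integral_messageLength_eq ⟨eigDir ρ.1 s, by
          rw [mem_sphere_zero_iff_norm, norm_eigDir]⟩
      simp only [expectedLength_qubitProtocol]
      change ∫ l, _ ∂(uniformSphere.prod uniformSphere) = _
      rw [integral_finsetSum _ fun s _ => hi ρ s]
      simp only [integral_const_mul, hs, ← Finset.sum_mul, ρ.sum_eigVal, one_mul]
    have : Nonempty (DensityMatrix 2) := ⟨pureState 0⟩
    simp only [h, Set.range_const]
    exact isLUB_singleton

/-- With `x = π (log₂ 3 - 3/2)`, about `0.267`, the cost times `π` is `3π/2 + cos x + sin (2x) / 2`,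
and the argument is small enough for low-order Taylor bounds. -/
theorem abs_averageCost_sub_lt : |averageCost - 1.89| < 0.005 := by
  obtain ⟨hL1, hL2⟩ := logb_two_three_mem
  set L := Real.logb 2 3 with hL
  have hp1 := Real.pi_gt_d4
  have hp2 := Real.pi_lt_d4
  have hpi := Real.pi_pos
  set u := L - 3 / 2 with hu
  have hu1 : 9 / 106 < u := by linarith
  have hu2 : u < 7 / 82 := by linarith
  set x := Real.pi * u with hx
  have hx1 : 0.2667 < x := by rw [hx]; nlinarith
  have hx2 : x < 0.2682 := by rw [hx]; nlinarith
  have s1 : Real.sin (Real.pi * L) = -Real.cos x := by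
    rw [show Real.pi * L = x + Real.pi / 2 + Real.pi by rw [hx, hu]; ring, Real.sin_add_pi,
      Real.sin_add_pi_div_two]
  have s2 : Real.sin (2 * Real.pi * L) = -Real.sin (2 * x) := by
    rw [show 2 * Real.pi * L = 2 * x + Real.pi + (1 : ℕ) * (2 * Real.pi) by
      rw [hx, hu]; push_cast; ring, Real.sin_add_nat_mul_two_pi, Real.sin_add_pi]
  have hc := abs_le.1 (Real.cos_bound (x := x) (by rw [abs_of_pos] <;> linarith))
  have hs := abs_le.1 (Real.sin_bound (x := 2 * x) (by rw [abs_of_pos] <;> linarith))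
  rw [abs_of_pos (by linarith)] at hc hs
  have x2l : 0.0711 < x ^ 2 := by nlinarith
  have x2u : x ^ 2 < 0.07194 := by nlinarith
  have x3l : 0.01896 < x ^ 3 := by nlinarith
  have x3u : x ^ 3 < 0.0193 := by nlinarith
  have x4u : x ^ 4 < 0.00518 := by nlinarith
  have x5u : x ^ 5 < 0.00139 := by nlinarith
  have hcost : averageCost * Real.pi =
      3 / 2 * Real.pi + Real.cos x + Real.sin (2 * x) / 2 := by
    rw [averageCost, ← hL, s1, s2]
    field_simp
    ring
  have hs1 := hs.1
  have hs2 := hs.2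
  have hc1 := hc.1
  have hc2 := hc.2
  ring_nf at hs1 hs2 hc1 hc2
  rw [abs_lt]
  constructor
  · have : (1.89 - 0.005) * Real.pi < averageCost * Real.pi := by
      rw [hcost]; ring_nf; linarith
    have := lt_of_mul_lt_mul_right this hpi.le
    linarith
  · have : averageCost * Real.pi < (1.89 + 0.005) * Real.pi := by
      rw [hcost]; ring_nf; linarith
    have := lt_of_mul_lt_mul_right this hpi.le
    linarith

/-! ### Worst-case cost and alphabet size -/

theorem exists_codeword_of_mem_sentMessages {l : Sphere2 × Sphere2} {c : Word}
    (h : c ∈ qubitProtocol.sentMessages l) : ∃ m, c = codeword l m := by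
  obtain ⟨ρ, hρ⟩ := h
  by_contra! hne
  have h0 : aliceProb ρ l c = 0 := Finset.sum_eq_zero fun s _ => by rw [if_neg (hne _), mul_zero]
  exact (show 0 < aliceProb ρ l c from hρ).ne' h0

theorem eigVal_pureState_true (t : ℝ) : eigVal (pureState t).1 true = 1 ∧
    eigDir (pureState t).1 true = !₂[Real.sin t, 0, Real.cos t] := by
  have hn : ‖(!₂[Real.sin t, 0, Real.cos t] : Vec3)‖ = 1 := by
    rw [EuclideanSpace.norm_eq]
    simp [Fin.sum_univ_three]
  have hb : ‖blochVec (pureState t).1‖ = 1 / 2 := by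
    rw [blochVec_pureState, norm_smul, hn]
    norm_num
  constructor
  · rw [eigVal, hb, blochScalar, (pureState t).2.2]
    norm_num [sgn]
  · have h0 : blochVec (pureState t).1 ≠ 0 := norm_ne_zero_iff.1 (by rw [hb]; norm_num)
    rw [eigDir, if_neg h0, hb, blochVec_pureState]
    simp only [sgn, if_true, smul_smul]
    norm_num

theorem codeword_mem_sentMessages (l : Sphere2 × Sphere2) (t : ℝ) :
    codeword l (regionIndex l !₂[Real.sin t, 0, Real.cos t]) ∈ qubitProtocol.sentMessages l := by
  refine ⟨pureState t, ?_⟩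
  obtain ⟨h1, h2⟩ := eigVal_pureState_true t
  have h := Finset.single_le_sum (f := fun s => eigVal (pureState t).1 s *
    (if codeword l (regionIndex l !₂[Real.sin t, 0, Real.cos t]) =
      codeword l (regionIndex l (eigDir (pureState t).1 s)) then (1 : ℝ) else 0))
    (fun s _ => mul_nonneg ((pureState t).eigVal_nonneg s) (by split_ifs <;> norm_num))
    (Finset.mem_univ true)
  beta_reduce at h
  rw [h1, h2, if_pos rfl, mul_one] at h
  exact one_pos.trans_le h

theorem hasWorstCaseCost_qubitProtocol : qubitProtocol.HasWorstCaseCost 3 := by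
  constructor
  · have hpi := Real.pi_pos
    have hn : ∀ t, (!₂[Real.sin t, 0, Real.cos t] : Vec3) ∈ Metric.sphere (0 : Vec3) 1 := by
      intro t
      rw [mem_sphere_zero_iff_norm, EuclideanSpace.norm_eq]
      simp [Fin.sum_univ_three]
    have hin : ∀ s t, inner ℝ (!₂[Real.sin s, 0, Real.cos s] : Vec3) !₂[Real.sin t, 0, Real.cos t] =
        Real.cos (s - t) := by
      intro s t
      rw [Real.cos_sub]
      simp [PiLp.inner_apply, Fin.sum_univ_three]
      ring
    set l : Sphere2 × Sphere2 := (⟨_, hn 0⟩, ⟨_, hn (Real.pi / 8)⟩) with hl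
    -- At the angle `π/8` the parameter is `2 ^ (1/8)`, and `2 ≤ (9/8) ^ 8`.
    have hangle : angleParam l ≤ 9 / 8 := by
      have : InnerProductGeometry.angle (l.1 : Vec3) (l.2 : Vec3) = Real.pi / 8 := by
        rw [InnerProductGeometry.angle, norm_eq_of_mem_sphere, norm_eq_of_mem_sphere, hin,
          mul_one, div_one, zero_sub, Real.cos_neg, Real.arccos_cos (by positivity) (by linarith)]
      rw [angleParam, this, ← Real.rpow_le_rpow_iff (z := 8) (by positivity) (by norm_num)
        (by norm_num), ← Real.rpow_mul (by norm_num),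
        show Real.pi / 8 / Real.pi * 8 = 1 by field_simp]
      norm_num
    -- This direction bisects the strip outside the first hemisphere and inside the second, whose
    -- codeword has three bits.
    set t := Real.pi / 2 + Real.pi / 16 with ht
    have hregion : regionIndex l !₂[Real.sin t, 0, Real.cos t] = (false, true) := by
      have h1 : Real.cos (t - 0) < 0 :=
        Real.cos_neg_of_pi_div_two_lt_of_lt (by linarith) (by linarith)
      have h2 : 0 < Real.cos (t - Real.pi / 8) :=
        Real.cos_pos_of_mem_Ioo ⟨by linarith, by linarith⟩
      simp only [regionIndex, hl, hin, stepBit]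
      rw [decide_eq_true h2.le, decide_eq_false (not_le.2 h1)]
    refine ⟨l, _, codeword_mem_sentMessages l t, ?_⟩
    rw [hregion, codeword, if_pos hangle]
    change wordLength _ = 3
    simp [codeAPlus, wordLength, digitLength]
    norm_num
  · rintro _ ⟨l, c, hc, rfl⟩
    obtain ⟨m, rfl⟩ := exists_codeword_of_mem_sentMessages hc
    exact wordLength_codeword_le l m

/-- The decoded region already labels the sent messages injectively, so four of the eight letters
suffice. -/
theorem fitsAlphabet_qubitProtocol : qubitProtocol.FitsAlphabet (2 ^ 3) := by
  refine ⟨fun l c => Fin.castLE (by norm_num : 4 ≤ 2 ^ 3)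
    (Fintype.equivFinOfCardEq (by simp : Fintype.card (Bool × Bool) = 4) (decodeWord l c)),
    fun l c hc c' hc' h => ?_⟩
  obtain ⟨m, rfl⟩ := exists_codeword_of_mem_sentMessages hc
  obtain ⟨m', rfl⟩ := exists_codeword_of_mem_sentMessages hc'
  have := (Fintype.equivFinOfCardEq _).injective (Fin.castLE_injective _ h)
  rw [decodeWord_codeword, decodeWord_codeword] at this
  rw [this]

end PrepareMeasure

open PrepareMeasure in
theorem mainTheorem1 :
    qubitProtocol.IsValid ∧
    Simulates 2 qubitProtocol ∧
    (∀ (l : Sphere2 × Sphere2) (m m' : Bool × Bool),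
      m ≠ m' → ¬ codeword l m <+: codeword l m') ∧
    qubitProtocol.HasAverageCost averageCost ∧
    |averageCost - 1.89| < 0.005 ∧
    qubitProtocol.HasWorstCaseCost 3 ∧
    qubitProtocol.FitsAlphabet (2 ^ 3) :=
  ⟨qubitProtocol_isValid, simulates_qubitProtocol, codeword_not_isPrefix,
    hasAverageCost_qubitProtocol, abs_averageCost_sub_lt, hasWorstCaseCost_qubitProtocol,
    fitsAlphabet_qubitProtocol⟩
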